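/- There are a deterministic random access machine program $P$ and a constant $C\in\mathbb{N}$ such that the following holds for all integers $n\ge 2$, $q\ge 1$, all integers $k_1,\dots,k_q\ge 0$ with $\sum_{i=1}^q k_i=\ell$, and every $n$-element set $U$ whose elements are numbered $0,\dots,n-1$. There is a list $\mathcal F$ of at most $q^{C\ell}\log_2 n$ functions $U\to\{1,\dots,q\}$ such that for any pairwise disjoint sets $A_1,\dots,A_q\subseteq U$ with $|A_i|=k_i$ for all $i$, some $f\in\mathcal F$ satisfies $f(x)=i$ for every $i\in\{1,\dots,q\}$ and every $x\in A_i$. Moreover, on input $n,q,\ell,k_1,\dots,k_q$ the program $P$ halts after at most $C\,q^{C\ell}\,n\log_2 n$ steps and outputs $\mathcal F$, as the list of the value tables of its members. That is, $|\mathcal F|\le q^{O(\ell)}\log n$, and $\mathcal F$ is computed in time $q^{O(\ell)}\,n\log n$. Here the machine is a word RAM: it has registers and finitely many memory arrays (initially $0$ apart from the input), and one step is a constant assignment, an operation $+,-,\cdot$, integer division or remainder on registers, an indirect load or store, a no-op, or a comparison that controls a branch or a loop. All numbers occurring in the run are below $(n+\ell+q^{\ell+1})^{C}$, i.e. words have $O(\log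 (n+\ell+q^{\ell+1}))$ bits. -/

import Mathlib

namespace WordRAM

/-- Arithmetic operations on words. Subtraction is truncated at `0`; `div` and `mod` are
quotient and remainder (with `a / 0 = 0` and `a % 0 = a`). -/
inductive Op where
  | add | sub | mul | div | mod

/-- The value of an arithmetic operation. -/
def Op.eval : Op → ℕ → ℕ → ℕ
  | .add, a, b => a + b
  | .sub, a, b => a - b
  | .mul, a, b => a * b
  | .div, a, b => a / b
  | .mod, a, b => a % b

/-- Programs of a random access machine, with the usual structured control flow. The machine has
registers `R 0, R 1, …` and memory banks `M 0, M 1, …`, each bank being an array of cells indexed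
by natural numbers; registers and banks are named by fixed numbers in the program text, so a program
uses only finitely many of them, whereas cells are addressed indirectly through registers. -/
inductive Program where
  /-- do nothing -/
  | skip
  /-- `R x := c` -/
  | const (x c : ℕ)
  /-- `R x := R y ∘ R z` -/
  | arith (o : Op) (x y z : ℕ)
  /-- `R x := M b [R a]` -/
  | load (x b a : ℕ)
  /-- `M b [R a] := R y` -/
  | store (b a y : ℕ)
  /-- `p; p'` -/
  | seq (p p' : Program)
  /-- `if R x < R y then p else p'` -/
  | ite (x y : ℕ) (p p' : Program)
  /-- `while R x < R y do p` -/
  | loop (x y : ℕ) (p : Program)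

/-- Contents of the registers and of the memory banks. -/
structure State where
  reg : ℕ → ℕ
  mem : ℕ → ℕ → ℕ

/-- Overwrite register `x` by `v`. -/
def State.setReg (s : State) (x v : ℕ) : State :=
  { s with reg := Function.update s.reg x v }

/-- Overwrite cell `a` of bank `b` by `v`. -/
def State.setMem (s : State) (b a v : ℕ) : State :=
  { s with mem := Function.update s.mem b (Function.update (s.mem b) a v) }

/-- `Run W p s t s'`: on a machine whose words hold the numbers `0, …, W - 1`, the program `p`,
started in state `s`, halts in state `s'` after exactly `t` unit-cost steps. Every elementary
instruction and every evaluation of a branching or loop condition costs one step. An instruction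
whose result is not smaller than `W` has no successor state: a run never overflows a word. -/
inductive Run (W : ℕ) : Program → State → ℕ → State → Prop where
  | skip (s : State) : Run W .skip s 1 s
  | const (s : State) (x c : ℕ) (h : c < W) : Run W (.const x c) s 1 (s.setReg x c)
  | arith (s : State) (o : Op) (x y z : ℕ) (h : o.eval (s.reg y) (s.reg z) < W) :
      Run W (.arith o x y z) s 1 (s.setReg x (o.eval (s.reg y) (s.reg z)))
  | load (s : State) (x b a : ℕ) (h : s.mem b (s.reg a) < W) :
      Run W (.load x b a) s 1 (s.setReg x (s.mem b (s.reg a)))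
  | store (s : State) (b a y : ℕ) (h : s.reg y < W) (h' : s.reg a < W) :
      Run W (.store b a y) s 1 (s.setMem b (s.reg a) (s.reg y))
  | seq (p p' : Program) (s s₁ s₂ : State) (t₁ t₂ : ℕ)
      (h₁ : Run W p s t₁ s₁) (h₂ : Run W p' s₁ t₂ s₂) : Run W (.seq p p') s (t₁ + t₂) s₂
  | ite_true (x y : ℕ) (p p' : Program) (s s₁ : State) (t : ℕ)
      (h : s.reg x < s.reg y) (h₁ : Run W p s t s₁) : Run W (.ite x y p p') s (t + 1) s₁
  | ite_false (x y : ℕ) (p p' : Program) (s s₁ : State) (t : ℕ)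
      (h : ¬ s.reg x < s.reg y) (h₁ : Run W p' s t s₁) : Run W (.ite x y p p') s (t + 1) s₁
  | loop_true (x y : ℕ) (p : Program) (s s₁ s₂ : State) (t₁ t₂ : ℕ)
      (h : s.reg x < s.reg y) (h₁ : Run W p s t₁ s₁) (h₂ : Run W (.loop x y p) s₁ t₂ s₂) :
      Run W (.loop x y p) s (t₁ + t₂ + 1) s₂
  | loop_false (x y : ℕ) (p : Program) (s : State)
      (h : ¬ s.reg x < s.reg y) : Run W (.loop x y p) s 1 s

end WordRAM

/-- The initial state on input `n, q, ℓ, k₁, …, k_q`: the first three numbers are in registers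
`0, 1, 2`, the sequence `k` is in the first `q` cells of bank `0`, everything else is `0`. -/
def inputState (n q ℓ : ℕ) (k : Fin q → ℕ) : WordRAM.State where
  reg x := if x = 0 then n else if x = 1 then q else if x = 2 then ℓ else 0
  mem b a := if h : b = 0 ∧ a < q then k ⟨a, h.2⟩ else 0

/-- The state `s` holds the list `F 0, …, F (m - 1)` of functions `U → [q]`: register `0` contains
`m`, and bank `1` contains the value tables of the functions one after the other, where the elements
of the `n`-element set `U` are ordered by the numbering `e` and the colours are `0, …, q - 1`. -/
def HoldsFamily {U : Type*} {n q m : ℕ} (e : U ≃ Fin n) (F : Fin m → U → Fin q)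
    (s : WordRAM.State) : Prop :=
  s.reg 0 = m ∧ ∀ (j : Fin m) (u : U), s.mem 1 (j * n + e u) = F j u

/-- Every choice of pairwise disjoint sets `A i ⊆ U` with `|A i| = k i` is coloured correctly by
some member of the family: it maps all of `A i` to `i`, for every `i`. -/
def SeparatesAll {U : Type*} {q m : ℕ} (k : Fin q → ℕ) (F : Fin m → U → Fin q) : Prop :=
  ∀ A : Fin q → Finset U, Pairwise (fun i j => Disjoint (A i) (A j)) → (∀ i, (A i).card = k i) →
    ∃ j, ∀ i, ∀ x ∈ A i, F j x = i

/-!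
The family is a composition of three levels of functions `U → [r] → [N] → [q]`, where
`r = O(ℓ² log n)` is prime and `N = 3 ℓ²`; no member depends on the `kᵢ`.

* The first level hashes `u < n` by the Reed–Solomon code: the base-`r` digits of `u` are the
  coefficients of a polynomial of degree less than `d = ⌈log_r n⌉`, which is evaluated at one of
  `ℓ² d` points of `𝔽_r`. Two elements collide at fewer than `d` points (`card_rsHash_collisions`).
* The second level consists of `T = N ⌈log₂ (r + 1)⌉` functions `[r] → [N]`, the rows of a matrix
  that is computed greedily by the method of multiplicative weights: the weight of a pair of columns
  doubles with each collision, and each entry is chosen in the bucket of least weight, so that the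
  total weight grows by a factor of at most `1 + 1 / N` per row (`ColumnOK.step`). Hence two columns
  agree in few rows (`ColumnOK.collisions_le`).
* The third level consists of the functions `g ↦ ⌊q (y x^g mod p) / p⌋` for `x, y < p`, where
  `p > N (4 q)^ℓ` is prime. Every colouring of every `ℓ`-subset of `[N]` occurs
  (`exists_geometric_colouring`): a colour class contains a translate of a difference set `J - J` of
  an interval, and the function counting representations as such differences has Fourier
  coefficients `|∑_{j ∈ J} e(a j / p)|²`, whose sum is known exactly. So the main term of the Fourier
  expansion dominates as soon as `p` is large; the error is bounded by the number of roots of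
  a polynomial (`exists_geometric_mem_differences`).

By a union bound over pairs of elements, some function of the first level, and then some function of
the second level, is injective on a given `ℓ`-set (`exists_familyColour_eq`). The number of
functions is `ℓ² d T p²`. The product `d ⌈log₂ (r + 1)⌉` is `O(ℓ log n)`, since `d` is about
`log n / log r` (`clog_mul_clog_le`); this is why a single factor `log n` suffices. All other factors
are bounded by powers of `q ^ ℓ` if `q ≥ 2` and `ℓ ≥ 1`; otherwise one constant function suffices.

The machine program is verified in a Hoare logic with time bounds: `Exec W p s T Q` says that `p`,
started in `s`, halts within `T` steps in a state satisfying `Q`.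
-/

/-! ### Hoare logic for the word RAM -/

namespace WordRAM

@[simp] theorem State.setReg_reg (s : State) (x v y : ℕ) :
    (s.setReg x v).reg y = if y = x then v else s.reg y := by
  simp [State.setReg, Function.update_apply]

@[simp] theorem State.setReg_mem (s : State) (x v : ℕ) : (s.setReg x v).mem = s.mem := rfl

@[simp] theorem State.setMem_reg (s : State) (b a v : ℕ) : (s.setMem b a v).reg = s.reg := rfl

@[simp] theorem State.setMem_mem (s : State) (b a v b' : ℕ) :
    (s.setMem b a v).mem b' = if b' = b then Function.update (s.mem b) a v else s.mem b' := by
  simp only [State.setMem, Function.update_apply]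

attribute [simp] Op.eval

/-- Whether the program text contains an instruction that writes register `y`. -/
def Program.writesReg : Program → ℕ → Bool
  | .skip, _ => false
  | .const x _, y => y == x
  | .arith _ x _ _, y => y == x
  | .load x _ _, y => y == x
  | .store _ _ _, _ => false
  | .seq p p', y => p.writesReg y || p'.writesReg y
  | .ite _ _ p p', y => p.writesReg y || p'.writesReg y
  | .loop _ _ p, y => p.writesReg y

/-- Whether the program text contains an instruction that writes to bank `b`. -/
def Program.writesMem : Program → ℕ → Bool
  | .skip, _ => false
  | .const _ _, _ => false
  | .arith _ _ _ _, _ => false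
  | .load _ _ _, _ => false
  | .store b _ _, b' => b' == b
  | .seq p p', b => p.writesMem b || p'.writesMem b
  | .ite _ _ p p', b => p.writesMem b || p'.writesMem b
  | .loop _ _ p, b => p.writesMem b

/-- The states `s` and `s'` differ only in registers and banks that `p` writes. -/
structure Frame (p : Program) (s s' : State) : Prop where
  reg : ∀ y, p.writesReg y = false → s'.reg y = s.reg y
  mem : ∀ b, p.writesMem b = false → s'.mem b = s.mem b

theorem Frame.refl (p : Program) (s : State) : Frame p s s := ⟨fun _ _ => rfl, fun _ _ => rfl⟩

theorem Frame.trans {p : Program} {s s' s'' : State} (h : Frame p s s') (h' : Frame p s' s'') :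
    Frame p s s'' :=
  ⟨fun y hy => (h'.reg y hy).trans (h.reg y hy), fun b hb => (h'.mem b hb).trans (h.mem b hb)⟩

theorem Run.frame {W : ℕ} {p : Program} {s s' : State} {t : ℕ} (h : Run W p s t s') :
    Frame p s s' := by
  induction h with
  | skip s => exact .refl _ _
  | const s x c h => exact ⟨fun y hy => by simp_all [Program.writesReg], fun b hb => rfl⟩
  | arith s o x y z h =>
    exact ⟨fun y hy => by simp_all [Program.writesReg], fun b hb => rfl⟩
  | load s x b a h => exact ⟨fun y hy => by simp_all [Program.writesReg], fun b hb => rfl⟩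
  | store s b a y h h' =>
    exact ⟨fun y hy => rfl, fun b hb => by simp_all [Program.writesMem]⟩
  | seq p p' s s₁ s₂ t₁ t₂ _ _ ih ih' =>
    refine ⟨fun y hy => ?_, fun b hb => ?_⟩
    · simp only [Program.writesReg, Bool.or_eq_false_iff] at hy
      rw [ih'.reg y hy.2, ih.reg y hy.1]
    · simp only [Program.writesMem, Bool.or_eq_false_iff] at hb
      rw [ih'.mem b hb.2, ih.mem b hb.1]
  | ite_true x y p p' s s₁ t h _ ih =>
    refine ⟨fun y hy => ?_, fun b hb => ?_⟩
    · simp only [Program.writesReg, Bool.or_eq_false_iff] at hy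
      exact ih.reg y hy.1
    · simp only [Program.writesMem, Bool.or_eq_false_iff] at hb
      exact ih.mem b hb.1
  | ite_false x y p p' s s₁ t h _ ih =>
    refine ⟨fun y hy => ?_, fun b hb => ?_⟩
    · simp only [Program.writesReg, Bool.or_eq_false_iff] at hy
      exact ih.reg y hy.2
    · simp only [Program.writesMem, Bool.or_eq_false_iff] at hb
      exact ih.mem b hb.2
  | loop_true x y p s s₁ s₂ t₁ t₂ h _ _ ih ih' =>
    exact Frame.trans (p := .loop x y p) ⟨ih.reg, ih.mem⟩ ih'
  | loop_false x y p s h => exact .refl _ _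

/-- Total correctness with a time bound: started in `s`, the program `p` halts after at most `T`
steps, without overflowing a word, in a state that satisfies `Q`. -/
def Exec (W : ℕ) (p : Program) (s : State) (T : ℕ) (Q : State → Prop) : Prop :=
  ∃ t s', t ≤ T ∧ Run W p s t s' ∧ Q s'

section rules

variable {W : ℕ} {p p' : Program} {s : State} {T T' : ℕ} {Q R : State → Prop}

theorem Exec.le (h : Exec W p s T Q) (hT : T ≤ T') : Exec W p s T' Q := by
  obtain ⟨t, s', ht, hr, hq⟩ := h
  exact ⟨t, s', ht.trans hT, hr, hq⟩

theorem Exec.imp (h : Exec W p s T R) (hQ : ∀ s', Frame p s s' → R s' → Q s') :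
    Exec W p s T Q := by
  obtain ⟨t, s', ht, hr, hq⟩ := h
  exact ⟨t, s', ht, hr, hQ s' hr.frame hq⟩

theorem Exec.skip (hQ : Q s) : Exec W .skip s 1 Q := ⟨1, s, le_rfl, .skip s, hQ⟩

theorem Exec.const {x c : ℕ} (h : c < W) (hQ : Q (s.setReg x c)) :
    Exec W (.const x c) s 1 Q := ⟨1, _, le_rfl, .const s x c h, hQ⟩

theorem Exec.arith {o : Op} {x y z : ℕ} (h : o.eval (s.reg y) (s.reg z) < W)
    (hQ : Q (s.setReg x (o.eval (s.reg y) (s.reg z)))) :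
    Exec W (.arith o x y z) s 1 Q := ⟨1, _, le_rfl, .arith s o x y z h, hQ⟩

theorem Exec.load {x b a : ℕ} (h : s.mem b (s.reg a) < W)
    (hQ : Q (s.setReg x (s.mem b (s.reg a)))) :
    Exec W (.load x b a) s 1 Q := ⟨1, _, le_rfl, .load s x b a h, hQ⟩

theorem Exec.store {b a y : ℕ} (h : s.reg y < W) (h' : s.reg a < W)
    (hQ : Q (s.setMem b (s.reg a) (s.reg y))) :
    Exec W (.store b a y) s 1 Q := ⟨1, _, le_rfl, .store s b a y h h', hQ⟩

theorem Exec.seq (h : Exec W p s T R)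
    (h' : ∀ s', Frame p s s' → R s' → Exec W p' s' T' Q) :
    Exec W (.seq p p') s (T + T') Q := by
  obtain ⟨t, s₁, ht, hr, hq⟩ := h
  obtain ⟨t', s₂, ht', hr', hq'⟩ := h' s₁ hr.frame hq
  exact ⟨t + t', s₂, by omega, .seq _ _ _ _ _ _ _ hr hr', hq'⟩

theorem Exec.seq_eq {s₁ : State} (h : Exec W p s T (· = s₁)) (h' : Exec W p' s₁ T' Q) :
    Exec W (.seq p p') s (T + T') Q :=
  h.seq fun _ _ e => e ▸ h'

theorem Exec.const_seq {x c : ℕ} (h : c < W) (h' : Exec W p' (s.setReg x c) T Q) :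
    Exec W (.seq (.const x c) p') s (T + 1) Q :=
  ((Exec.const (Q := (· = _)) h rfl).seq_eq h').le (by omega)

theorem Exec.arith_seq {o : Op} {x y z : ℕ} (h : o.eval (s.reg y) (s.reg z) < W)
    (h' : Exec W p' (s.setReg x (o.eval (s.reg y) (s.reg z))) T Q) :
    Exec W (.seq (.arith o x y z) p') s (T + 1) Q :=
  ((Exec.arith (Q := (· = _)) h rfl).seq_eq h').le (by omega)

theorem Exec.load_seq {x b a : ℕ} (h : s.mem b (s.reg a) < W)
    (h' : Exec W p' (s.setReg x (s.mem b (s.reg a))) T Q) :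
    Exec W (.seq (.load x b a) p') s (T + 1) Q :=
  ((Exec.load (Q := (· = _)) h rfl).seq_eq h').le (by omega)

theorem Exec.store_seq {b a y : ℕ} (h : s.reg y < W) (h₁ : s.reg a < W)
    (h' : Exec W p' (s.setMem b (s.reg a) (s.reg y)) T Q) :
    Exec W (.seq (.store b a y) p') s (T + 1) Q :=
  ((Exec.store (Q := (· = _)) h h₁ rfl).seq_eq h').le (by omega)

theorem Exec.ite {x y : ℕ} (h : s.reg x < s.reg y → Exec W p s T Q)
    (h' : ¬ s.reg x < s.reg y → Exec W p' s T' Q) :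
    Exec W (.ite x y p p') s (T + T' + 1) Q := by
  by_cases hxy : s.reg x < s.reg y
  · obtain ⟨t, s', ht, hr, hq⟩ := h hxy
    exact ⟨t + 1, s', by omega, .ite_true _ _ _ _ _ _ _ hxy hr, hq⟩
  · obtain ⟨t, s', ht, hr, hq⟩ := h' hxy
    exact ⟨t + 1, s', by omega, .ite_false _ _ _ _ _ _ _ hxy hr, hq⟩

end rules

/-- Increment register `x`, using register `3` for the summand `1`. -/
def incr (x : ℕ) : Program := .seq (.const 3 1) (.arith .add x x 3)

/-- Copy register `y` to register `x`; register `4` is never written and holds `0`. -/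
def move (x y : ℕ) : Program := .arith .add x y 4

/-- `for R i := 0, …, R B - 1 do p` -/
def forLoop (i B : ℕ) (p : Program) : Program :=
  .seq (.const i 0) (.loop i B (.seq p (incr i)))

theorem Exec.incr {W x : ℕ} {s : State} {Q : State → Prop} (h1 : 1 < W) (h3 : x ≠ 3)
    (h : s.reg x + 1 < W) (hQ : Q ((s.setReg 3 1).setReg x (s.reg x + 1))) :
    Exec W (incr x) s 2 Q :=
  Exec.const_seq h1 (Exec.arith (by simpa [h3] using h) (by simpa [h3] using hQ))

theorem Exec.incr_seq {W x T : ℕ} {p : Program} {s : State} {Q : State → Prop} (h1 : 1 < W)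
    (h3 : x ≠ 3) (h : s.reg x + 1 < W)
    (h' : Exec W p ((s.setReg 3 1).setReg x (s.reg x + 1)) T Q) :
    Exec W (.seq (WordRAM.incr x) p) s (T + 2) Q :=
  ((Exec.incr (Q := (· = _)) h1 h3 h rfl).seq_eq h').le (by omega)

/-- The invariant rule for counting loops. The invariant is asked for in the state in which the
counter has its new value; everything that the body does not write keeps its value by `Frame`, so
the invariant need not mention it. -/
theorem Exec.forLoop {W i B N T : ℕ} {p : Program} {s : State} {Q : State → Prop}
    (Inv : ℕ → State → Prop) (hN : s.reg B = N) (hNW : N < W) (h1 : 1 < W)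
    (hi3 : i ≠ 3 ∧ B ≠ 3 ∧ i ≠ B) (hp : p.writesReg i = false ∧ p.writesReg B = false)
    (h0 : Inv 0 (s.setReg i 0))
    (hstep : ∀ j s₁, j < N → s₁.reg i = j → Frame (WordRAM.forLoop i B p) s s₁ → Inv j s₁ →
      Exec W p s₁ T (fun s₂ => Inv (j + 1) ((s₂.setReg 3 1).setReg i (j + 1))))
    (hQ : ∀ s₁, Frame (WordRAM.forLoop i B p) s s₁ → Inv N s₁ → Q s₁) :
    Exec W (WordRAM.forLoop i B p) s (N * (T + 3) + 2) Q := by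
  obtain ⟨hi3, hB3, hiB⟩ := hi3
  have hwB : (WordRAM.forLoop i B p).writesReg B = false := by
    simp [WordRAM.forLoop, WordRAM.incr, Program.writesReg, hp.2, hB3, hiB.symm]
  have key : ∀ c j s₁, j + c = N → s₁.reg i = j → Frame (WordRAM.forLoop i B p) s s₁ → Inv j s₁ →
      Exec W (.loop i B (.seq p (WordRAM.incr i))) s₁ (c * (T + 3) + 1) Q := by
    intro c
    induction c with
    | zero =>
      intro j s₁ hj hi hf hI
      have hb : s₁.reg B = N := (hf.reg B hwB).trans hN
      exact ⟨1, s₁, by omega, .loop_false _ _ _ _ (by omega),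
        hQ s₁ hf (by rwa [← (by omega : j = N)])⟩
    | succ c ih =>
      intro j s₁ hj hi hf hI
      have hb : s₁.reg B = N := (hf.reg B hwB).trans hN
      obtain ⟨t, s₂, ht, hr, hq⟩ := hstep j s₁ (by omega) hi hf hI
      have hi2 : s₂.reg i = j := (hr.frame.reg i hp.1).trans hi
      obtain ⟨t₂, s₃, ht₂, hr₂, rfl⟩ : Exec W (WordRAM.incr i) s₂ 2
          (· = (s₂.setReg 3 1).setReg i (j + 1)) :=
        Exec.incr h1 hi3 (by omega) (by rw [hi2])
      have hrb := Run.seq _ _ _ _ _ _ _ hr hr₂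
      have hf' : Frame (WordRAM.forLoop i B p) s₁ ((s₂.setReg 3 1).setReg i (j + 1)) :=
        ⟨fun y hy => hrb.frame.reg y (by
            simp only [WordRAM.forLoop, Program.writesReg, Bool.or_eq_false_iff] at hy ⊢
            exact hy.2),
          fun b hb => hrb.frame.mem b (by
            simp only [WordRAM.forLoop, Program.writesMem, Bool.or_eq_false_iff] at hb ⊢
            exact hb.2)⟩
      obtain ⟨t₃, s₄, ht₃, hr₃, hq₃⟩ := ih (j + 1) _ (by omega) (by simp) (hf.trans hf') hq
      refine ⟨_, s₄, ?_, .loop_true _ _ _ _ _ _ _ _ (by omega) hrb hr₃, hq₃⟩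
      rw [Nat.succ_mul]; omega
  have h := Exec.const_seq (x := i) (c := 0) (by omega) (key N 0 (s.setReg i 0) (by omega) (by simp)
    ⟨fun y hy => by
        have : y ≠ i := by
          rintro rfl; simp [WordRAM.forLoop, Program.writesReg] at hy
        simp [this], fun b _ => rfl⟩ h0)
  exact h.le (by omega)

end WordRAM

/-! ### Geometric sequences modulo a prime meet all boxes -/

section Fourier

open Finset

variable {p : ℕ} [Fact p.Prime]

/-- The Fourier coefficient `∑_{j ∈ J} e(a j / p)` of a set of residues. -/
noncomputable def expSum (J : Finset (ZMod p)) (a : ZMod p) : ℂ :=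
  ∑ j ∈ J, ZMod.stdAddChar (a * j)

theorem norm_expSum_sq (J : Finset (ZMod p)) (a : ZMod p) :
    ((‖expSum J a‖ ^ 2 : ℝ) : ℂ) = ∑ j ∈ J, ∑ j' ∈ J, ZMod.stdAddChar (a * (j - j')) := by
  have : ((‖expSum J a‖ ^ 2 : ℝ) : ℂ) = expSum J a * (starRingEnd ℂ) (expSum J a) := by
    rw [Complex.mul_conj, Complex.normSq_eq_norm_sq]
  rw [this, expSum, map_sum, sum_mul_sum]
  refine sum_congr rfl fun j _ => sum_congr rfl fun j' _ => ?_
  rw [AddChar.starComp_apply (by simp [ZMod.ringChar_zmod_n, (Fact.out : p.Prime).pos])]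
  rw [AddChar.inv_apply, ← AddChar.map_add_eq_mul]
  congr 1; ring

/-- Fourier inversion for the number of representations of `z` as a difference of elements of `J`;
all its Fourier coefficients are nonnegative. -/
theorem sum_norm_expSum_sq (J : Finset (ZMod p)) (z : ZMod p) :
    ∑ a, ((‖expSum J a‖ ^ 2 : ℝ) : ℂ) * ZMod.stdAddChar (a * z) =
      p * #{jj ∈ J ×ˢ J | z = jj.2 - jj.1} := by
  simp_rw [norm_expSum_sq, sum_mul]
  rw [sum_comm]
  simp_rw [sum_comm (s := univ), ← AddChar.map_add_eq_mul, ← mul_add,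
    AddChar.sum_mulShift _ (ZMod.isPrimitive_stdAddChar p)]
  push_cast
  rw [← sum_product', ← sum_filter, sum_const, nsmul_eq_mul, ZMod.card, mul_comm]
  congr 3
  ext ⟨j, j'⟩
  simp only [mem_filter, and_congr_right_iff]
  intro _
  rw [add_comm, ← eq_neg_iff_add_eq_zero, neg_sub]

theorem parseval_expSum (J : Finset (ZMod p)) : ∑ a, ‖expSum J a‖ ^ 2 = (p * #J : ℝ) := by
  have h := sum_norm_expSum_sq J 0
  have hc : #{jj ∈ J ×ˢ J | (0 : ZMod p) = jj.2 - jj.1} = #J := by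
    rw [← card_image_of_injective J (f := fun j => (j, j)) (fun a b h => (Prod.ext_iff.1 h).1)]
    congr 1
    ext ⟨j, j'⟩
    simp only [mem_filter, mem_product, mem_image, Prod.mk.injEq, eq_comm (a := (0 : ZMod p)),
      sub_eq_zero]
    constructor
    · rintro ⟨⟨h1, h2⟩, rfl⟩; exact ⟨_, h1, rfl, rfl⟩
    · rintro ⟨a, h, rfl, rfl⟩; exact ⟨⟨h, h⟩, rfl⟩
  rw [hc] at h
  simp only [mul_zero, AddChar.map_zero_eq_one, mul_one] at h
  exact_mod_cast h

theorem AddChar.map_finset_sum {ι A M : Type*} [AddCommMonoid A] [CommMonoid M] (ψ : AddChar A M)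
    (s : Finset ι) (f : ι → A) : ψ (∑ i ∈ s, f i) = ∏ i ∈ s, ψ (f i) := by
  classical
  induction s using Finset.induction_on with
  | empty => simp
  | insert a s ha ih => rw [sum_insert ha, prod_insert ha, AddChar.map_add_eq_mul, ih]

theorem card_roots_sparse {N : ℕ} (S : Finset ℕ) (hS : S ⊆ range N) (a : S → ZMod p) (ha : a ≠ 0) :
    #{x : ZMod p | ∑ i, a i * x ^ (i : ℕ) = 0} ≤ N := by
  classical
  obtain ⟨i₀, hi₀⟩ := Function.ne_iff.1 ha
  set f : Polynomial (ZMod p) := ∑ i : S, Polynomial.monomial (i : ℕ) (a i) with hf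
  have hc : f.coeff i₀ = a i₀ := by
    rw [hf, Polynomial.finsetSum_coeff, sum_eq_single i₀]
    · simp
    · intro b _ hb
      rw [Polynomial.coeff_monomial, if_neg (fun h => hb (Subtype.ext h))]
    · simp
  have hf0 : f ≠ 0 := fun h => hi₀ (by rw [← hc, h]; simp)
  have hd : f.degree < N := by
    refine Polynomial.mem_degreeLT.1 (Submodule.sum_mem _ fun i _ => Polynomial.mem_degreeLT.2 ?_)
    refine (Polynomial.degree_monomial_le _ _).trans_lt ?_
    exact_mod_cast mem_range.1 (hS i.2)
  calc #{x : ZMod p | ∑ i, a i * x ^ (i : ℕ) = 0} ≤ #f.roots.toFinset := by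
        refine card_le_card fun x hx => ?_
        simp only [mem_filter, mem_univ, true_and] at hx
        rw [Multiset.mem_toFinset, Polynomial.mem_roots hf0, Polynomial.IsRoot.def, hf,
          Polynomial.eval_finsetSum]
        simpa using hx
    _ ≤ Multiset.card f.roots := Multiset.toFinset_card_le _
    _ ≤ N := by
        have := Polynomial.card_roots hf0
        exact_mod_cast this.trans hd.le

/-- The vectors `(y xⁱ)_{i ∈ S}` with `x, y ∈ 𝔽_p` are distributed so evenly that they meet every
translate of `(J - J)^S`. This is positivity of a Fourier series: the zero frequency contributes
`|J|^{2|S|} p²`, and the others are controlled because a nonzero polynomial with exponents in `S`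
has few roots. -/
theorem exists_geometric_mem_differences {N : ℕ} (S : Finset ℕ) (hS : S ⊆ range N)
    (J : Finset (ZMod p)) (c : ℕ → ZMod p) (hJ : p ^ #S * N < #J ^ #S * p) :
    ∃ x y : ZMod p, ∀ i ∈ S, ∃ j ∈ J, ∃ j' ∈ J, y * x ^ i - c i = j' - j := by
  classical
  by_contra hcon
  push Not at hcon
  have hp : 0 < p := (Fact.out : p.Prime).pos
  -- otherwise this product, which counts representations, vanishes for all `x` and `y`
  have hzero : ∀ x y : ZMod p, ∏ i : S, ∑ a, ((‖expSum J a‖ ^ 2 : ℝ) : ℂ) *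
      ZMod.stdAddChar (a * (y * x ^ (i : ℕ) - c i)) = 0 := by
    intro x y
    obtain ⟨i, hi, h⟩ := hcon x y
    refine prod_eq_zero (mem_univ ⟨i, hi⟩) ?_
    rw [sum_norm_expSum_sq]
    have : #{jj ∈ J ×ˢ J | y * x ^ i - c i = jj.2 - jj.1} = 0 := by
      rw [card_eq_zero, filter_eq_empty_iff]
      rintro ⟨j, j'⟩ hjj
      exact h j (mem_product.1 hjj).1 j' (mem_product.1 hjj).2
    simp [this]
  -- the frequency `a` contributes `B a`, a phase `u a`, and `p` times the number `Z a` of roots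
  let B : (S → ZMod p) → ℝ := fun a => ∏ i, ‖expSum J (a i)‖ ^ 2
  let u : (S → ZMod p) → ℂ := fun a => ∏ i, ZMod.stdAddChar (-(a i * c i))
  let Z : (S → ZMod p) → ℕ := fun a => #{x : ZMod p | ∑ i, a i * x ^ (i : ℕ) = 0}
  have hsum : ∑ a : S → ZMod p, (B a : ℂ) * u a * (p * Z a) = 0 := by
    have h0 : ∑ x : ZMod p, ∑ y : ZMod p, ∏ i : S, ∑ a, ((‖expSum J a‖ ^ 2 : ℝ) : ℂ) *
      ZMod.stdAddChar (a * (y * x ^ (i : ℕ) - c i)) = 0 :=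
      sum_eq_zero fun x _ => sum_eq_zero fun y _ => hzero x y
    simp_rw [prod_univ_sum, Fintype.piFinset_univ] at h0
    rw [← h0]
    simp_rw [sum_comm (s := (univ : Finset (ZMod p))) (t := (univ : Finset (S → ZMod p)))]
    refine sum_congr rfl fun a _ => ?_
    have hterm : ∀ x y : ZMod p, ∏ i : S, ((‖expSum J (a i)‖ ^ 2 : ℝ) : ℂ) *
        ZMod.stdAddChar (a i * (y * x ^ (i : ℕ) - c i)) =
        (B a : ℂ) * u a * ZMod.stdAddChar (y * ∑ i, a i * x ^ (i : ℕ)) := by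
      intro x y
      rw [prod_mul_distrib, mul_assoc]
      congr 1
      · simp [B]
      · rw [mul_sum, AddChar.map_finset_sum, ← prod_mul_distrib]
        refine prod_congr rfl fun i _ => ?_
        rw [← AddChar.map_add_eq_mul]
        congr 1; ring
    simp_rw [hterm, ← mul_sum, AddChar.sum_mulShift _ (ZMod.isPrimitive_stdAddChar p)]
    congr 1
    push_cast
    rw [← sum_filter, sum_const, nsmul_eq_mul, ZMod.card, mul_comm]
  rw [← add_sum_erase _ _ (mem_univ 0)] at hsum
  have hB0 : (B 0 : ℂ) * u 0 * (p * Z 0) = (((#J : ℝ) ^ #S) ^ 2 * p ^ 2 : ℝ) := by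
    simp [B, u, Z, expSum, ZMod.card]
    ring
  have hnorm : ‖∑ a ∈ univ.erase 0, (B a : ℂ) * u a * (p * Z a)‖ ≤
      (p * #J : ℝ) ^ #S * (p * N) := by
    calc _ ≤ ∑ a ∈ univ.erase (0 : S → ZMod p), B a * (p * N) := by
          refine norm_sum_le_of_le _ fun a ha => ?_
          have hBn : 0 ≤ B a := prod_nonneg fun i _ => by positivity
          have hu : ‖u a‖ = 1 := by simp [u, norm_prod]
          rw [norm_mul, norm_mul, norm_mul, hu, Complex.norm_real, Real.norm_of_nonneg hBn, mul_one,
            Complex.norm_natCast, Complex.norm_natCast]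
          have := card_roots_sparse S hS a (ne_of_mem_erase ha)
          gcongr
      _ ≤ ∑ a, B a * (p * N) := by
          refine sum_le_univ_sum_of_nonneg fun a => ?_
          have hBn : 0 ≤ B a := prod_nonneg fun i _ => by positivity
          positivity
      _ = (p * #J : ℝ) ^ #S * (p * N) := by
          rw [← sum_mul, ← parseval_expSum J]
          congr 1
          rw [show (#S) = #(univ : Finset S) by simp, ← prod_const, prod_univ_sum,
            Fintype.piFinset_univ]
  rw [hB0, ← eq_neg_iff_add_eq_zero] at hsum
  have h1 := congrArg norm hsum
  rw [norm_neg, Complex.norm_real, Real.norm_of_nonneg (by positivity)] at h1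
  rw [← h1] at hnorm
  have hJpos : 0 < #J ^ #S := by
    rcases Nat.eq_zero_or_pos (#J ^ #S) with h | h
    · simp [h] at hJ
    · exact h
  have h2 : (p : ℝ) ^ #S * N < (#J : ℝ) ^ #S * p := by exact_mod_cast hJ
  have h3 : (0 : ℝ) < (#J : ℝ) ^ #S := by exact_mod_cast hJpos
  have hp' : (0 : ℝ) < p := by exact_mod_cast hp
  have h4 := mul_lt_mul_of_pos_left h2 (mul_pos h3 hp')
  rw [mul_pow] at hnorm
  nlinarith

end Fourier

/-! ### The three levels of the construction -/

section Combinatorics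

open Finset

/-- Among the functions `z ↦ ⌊q (y xⁱ mod p) / p⌋` of `i`, for `x, y < p`, every colouring of every
small set `S` of exponents occurs. -/
theorem exists_geometric_colouring {p N q ℓ : ℕ} (hp : p.Prime) (hq : 1 ≤ q) (hpq : 2 * q ≤ p)
    (hP : N * (4 * q) ^ ℓ < p) (S : Finset ℕ) (hS : S ⊆ range N) (hcard : #S ≤ ℓ) (col : ℕ → ℕ)
    (hcol : ∀ i ∈ S, col i < q) :
    ∃ x < p, ∃ y < p, ∀ i ∈ S, y * x ^ i % p * q / p = col i := by
  have : Fact p.Prime := ⟨hp⟩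
  have hp0 : 0 < p := hp.pos
  -- `J` is an interval of length `w`, and `J - J` fits into each of the `q` colour classes.
  set w := p / (2 * q) with hw
  have hw1 : 1 ≤ w := (Nat.one_le_div_iff (by omega)).2 hpq
  have hwle : w * (2 * q) ≤ p := Nat.div_mul_le_self _ _
  have hwlt : p < 2 * q * (w + 1) := Nat.lt_mul_div_succ p (by omega)
  have hwp : w ≤ p := by nlinarith
  set J : Finset (ZMod p) := (range w).image (fun a : ℕ => (a : ZMod p)) with hJdef
  have hJcard : #J = w := by
    rw [hJdef, card_image_of_injOn, card_range]
    intro a ha b hb hab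
    simp only [coe_range, Set.mem_Iio] at ha hb
    have := (ZMod.natCast_eq_natCast_iff' a b p).1 hab
    rwa [Nat.mod_eq_of_lt (by omega), Nat.mod_eq_of_lt (by omega)] at this
  -- the colour class of `col i` starts at `st i`
  let st : ℕ → ℕ := fun i => (col i * p + (q - 1)) / q
  have hst1 : ∀ i, col i * p ≤ st i * q := fun i => by
    have := Nat.lt_mul_div_succ (col i * p + (q - 1)) (show 0 < q by omega)
    have h2 : q * ((col i * p + (q - 1)) / q + 1) = st i * q + q := by simp only [st]; ring
    omega
  have hst2 : ∀ i, st i * q ≤ col i * p + (q - 1) := fun i => Nat.div_mul_le_self _ _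
  obtain ⟨x, y, hxy⟩ := exists_geometric_mem_differences S hS J
    (fun i => ((st i + (w - 1) : ℕ) : ZMod p)) (by
      rw [hJcard]
      have h4 : p ≤ 4 * q * w := by nlinarith
      calc p ^ #S * N ≤ (4 * q * w) ^ #S * N := by gcongr
        _ = w ^ #S * (N * (4 * q) ^ #S) := by rw [mul_pow]; ring
        _ ≤ w ^ #S * (N * (4 * q) ^ ℓ) := by
            gcongr
            omega
        _ < w ^ #S * p := by
            have : 0 < w ^ #S := by positivity
            gcongr)
  refine ⟨x.val, x.val_lt, y.val, y.val_lt, fun i hi => ?_⟩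
  obtain ⟨j, hj, j', hj', h⟩ := hxy i hi
  simp only [hJdef, mem_image, mem_range] at hj hj'
  obtain ⟨a, ha, rfl⟩ := hj
  obtain ⟨b, hb, rfl⟩ := hj'
  set z := st i + (w - 1 - a) + b with hz
  have hzq : z * q < (col i + 1) * p := by
    have h1 : z ≤ st i + 2 * (w - 1) := by omega
    have h2 : z * q ≤ st i * q + 2 * (w - 1) * q := by rw [← add_mul]; gcongr
    have h3 : 2 * (w - 1) * q + 2 * q = w * (2 * q) := by
      obtain ⟨w', hw'⟩ : ∃ w', w = w' + 1 := ⟨w - 1, by omega⟩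
      rw [hw']; simp only [Nat.add_sub_cancel]; ring
    have := hst2 i
    rw [show (col i + 1) * p = col i * p + p by ring]
    omega
  have hzp : z < p := by
    have : (col i + 1) * p ≤ q * p := Nat.mul_le_mul_right _ (hcol i hi)
    by_contra hc
    have : p * q ≤ z * q := Nat.mul_le_mul_right _ (by omega)
    nlinarith
  have hmod : y.val * x.val ^ i % p = z := by
    have : ((y.val * x.val ^ i : ℕ) : ZMod p) = (z : ℕ) := by
      push_cast
      rw [ZMod.natCast_zmod_val, ZMod.natCast_zmod_val, sub_eq_iff_eq_add.1 h, hz]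
      rw [show st i + (w - 1) = st i + (w - 1 - a) + a by omega]
      push_cast; ring
    rw [(ZMod.natCast_eq_natCast_iff' _ _ _).1 this, Nat.mod_eq_of_lt hzp]
  rw [hmod]
  have h5 : col i * p ≤ z * q := (hst1 i).trans (Nat.mul_le_mul_right _ (by omega))
  exact Nat.div_eq_of_lt_le h5 hzq

/-- The Reed–Solomon code as a hash function: the base-`r` digits of `u` are the coefficients of a
polynomial, which is evaluated at `a` modulo `r`. -/
def rsHash (r a u : ℕ) : ℕ := Nat.ofDigits a (Nat.digits r u) % r

theorem rsHash_zero (r a : ℕ) : rsHash r a 0 = 0 := by simp [rsHash]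

theorem rsHash_lt {r : ℕ} (hr : 0 < r) (a u : ℕ) : rsHash r a u < r := Nat.mod_lt _ hr

theorem rsHash_eq {r : ℕ} (hr : 2 ≤ r) (a u : ℕ) :
    rsHash r a u = (rsHash r a (u / r) * a + u % r) % r := by
  rcases Nat.eq_zero_or_pos u with rfl | hu
  · simp [rsHash_zero]
  · rw [rsHash, Nat.digits_def' hr hu, Nat.ofDigits_cons, rsHash, Nat.add_mod, Nat.add_mod (_ * a),
      Nat.mod_mul_mod, add_comm, mul_comm a]

/-- The polynomial whose coefficients are the last `d` base-`r` digits of `u`. -/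
noncomputable def digitPoly (r : ℕ) : ℕ → ℕ → Polynomial (ZMod r)
  | 0, _ => 0
  | d + 1, u => Polynomial.C ((u % r : ℕ) : ZMod r) + Polynomial.X * digitPoly r d (u / r)

theorem digitPoly_degree_lt (r : ℕ) [Fact r.Prime] (d u : ℕ) : (digitPoly r d u).degree < d := by
  induction d generalizing u with
  | zero => simp [digitPoly]
  | succ d ih =>
    refine (Polynomial.degree_add_le _ _).trans_lt (max_lt ?_ ?_)
    · exact Polynomial.degree_C_le.trans_lt (by exact_mod_cast Nat.succ_pos d)
    · rw [Polynomial.degree_mul, Polynomial.degree_X]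
      by_cases h0 : digitPoly r d (u / r) = 0
      · simp [h0]
      · have := ih (u / r)
        rw [Polynomial.degree_eq_natDegree h0] at this ⊢
        norm_cast at this ⊢
        omega

theorem digitPoly_injOn (r : ℕ) [Fact r.Prime] (d u v : ℕ) (hu : u < r ^ d) (hv : v < r ^ d)
    (h : digitPoly r d u = digitPoly r d v) : u = v := by
  have hr : 0 < r := (Fact.out : r.Prime).pos
  induction d generalizing u v with
  | zero => simp at hu hv; omega
  | succ d ih =>
    have h0 := congrArg (Polynomial.eval 0) h
    simp only [digitPoly, Polynomial.eval_add, Polynomial.eval_C, Polynomial.eval_mul,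
      Polynomial.eval_X, zero_mul, add_zero] at h0
    have hm : u % r = v % r := by
      have := (ZMod.natCast_eq_natCast_iff' _ _ _).1 h0
      simpa using this
    simp only [digitPoly, hm] at h
    have h1 := mul_left_cancel₀ Polynomial.X_ne_zero (add_left_cancel h)
    have h2 := ih (u / r) (v / r) (Nat.div_lt_of_lt_mul (by rwa [pow_succ'] at hu))
      (Nat.div_lt_of_lt_mul (by rwa [pow_succ'] at hv)) h1
    rw [← Nat.mod_add_div u r, ← Nat.mod_add_div v r, hm, h2]

theorem digitPoly_eval (r : ℕ) [Fact r.Prime] (d u a : ℕ) (hu : u < r ^ d) :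
    (digitPoly r d u).eval (a : ZMod r) = (rsHash r a u : ℕ) := by
  have hr : 2 ≤ r := (Fact.out : r.Prime).two_le
  induction d generalizing u with
  | zero =>
    simp at hu
    simp [hu, digitPoly, rsHash_zero]
  | succ d ih =>
    rw [rsHash_eq hr, digitPoly]
    simp only [Polynomial.eval_add, Polynomial.eval_C, Polynomial.eval_mul, Polynomial.eval_X]
    rw [ih _ (Nat.div_lt_of_lt_mul (by rwa [pow_succ'] at hu)), ZMod.natCast_mod]
    simp only [ZMod.natCast_mod]
    push_cast
    simp only [ZMod.natCast_mod]
    ring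

/-- Distinct polynomials of degree less than `d` agree at no more than `d - 1` points. -/
theorem card_rsHash_collisions {r d M u v : ℕ} (hr : r.Prime) (hM : M ≤ r) (hu : u < r ^ d)
    (hv : v < r ^ d) (huv : u ≠ v) : #{a ∈ range M | rsHash r a u = rsHash r a v} ≤ d - 1 := by
  have : Fact r.Prime := ⟨hr⟩
  set f := digitPoly r d u - digitPoly r d v with hf
  have hf0 : f ≠ 0 := fun h => huv (digitPoly_injOn r d u v hu hv (sub_eq_zero.1 h))
  have hd : f.natDegree < d := by
    have : f.degree < d := (Polynomial.degree_sub_le _ _).trans_lt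
      (max_lt (digitPoly_degree_lt r d u) (digitPoly_degree_lt r d v))
    rwa [Polynomial.degree_eq_natDegree hf0, Nat.cast_lt] at this
  have : #{a ∈ range M | rsHash r a u = rsHash r a v} ≤ #f.roots.toFinset := by
    refine card_le_card_of_injOn (fun a : ℕ => (a : ZMod r)) ?_ ?_
    · intro a ha
      simp only [coe_filter, mem_range, Set.mem_ofPred_eq] at ha
      simp only [mem_coe, Multiset.mem_toFinset]
      rw [Polynomial.mem_roots hf0, Polynomial.IsRoot.def, hf, Polynomial.eval_sub,
        digitPoly_eval r d u a hu, digitPoly_eval r d v a hv, ha.2, sub_self]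
    · intro a ha b hb hab
      simp only [coe_filter, mem_range, Set.mem_ofPred_eq] at ha hb
      have := (ZMod.natCast_eq_natCast_iff' a b r).1 hab
      rwa [Nat.mod_eq_of_lt (by omega), Nat.mod_eq_of_lt (by omega)] at this
  have h2 := (Multiset.toFinset_card_le f.roots).trans (Polynomial.card_roots' f)
  omega

/-- Union bound: if every pair of points collides under few of the functions, one function is
injective on a given small set. -/
theorem exists_injOn_of_few_collisions {κ β : Type*} [DecidableEq κ] [DecidableEq β] {M c ℓ : ℕ}
    (S : Finset κ) (f : ℕ → κ → β) (hS : #S ≤ ℓ)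
    (hc : ∀ x ∈ S, ∀ y ∈ S, x ≠ y → #{t ∈ range M | f t x = f t y} ≤ c)
    (hM : ℓ * (ℓ - 1) * c < M) : ∃ t < M, Set.InjOn (f t) S := by
  by_contra hcon
  push Not at hcon
  have hsub : range M ⊆ S.offDiag.biUnion
      fun xy => {t ∈ range M | f t xy.1 = f t xy.2} := by
    intro t ht
    have h := hcon t (mem_range.1 ht)
    simp only [Set.InjOn, not_forall] at h
    obtain ⟨x, hx, y, hy, hxy, hne⟩ := h
    exact mem_biUnion.2 ⟨(x, y), mem_offDiag.2 ⟨hx, hy, hne⟩, mem_filter.2 ⟨ht, hxy⟩⟩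
  have h1 := card_le_card hsub
  have h2 := card_biUnion_le_card_mul S.offDiag
    (fun xy => {t ∈ range M | f t xy.1 = f t xy.2}) c (fun xy hxy => by
      obtain ⟨hx, hy, hne⟩ := mem_offDiag.1 hxy
      exact hc _ hx _ hy hne)
  rw [card_range] at h1
  have h3 : #S.offDiag ≤ ℓ * (ℓ - 1) := by
    rw [offDiag_card, ← Nat.mul_sub_one]
    gcongr
  have := Nat.mul_le_mul_right c h3
  omega

/-- The number of rows `t' < t` of the matrix `g`, stored with row length `r`, in which columns `y`
and `y'` agree. -/
def collisions (g : ℕ → ℕ) (r t y y' : ℕ) : ℕ := #{t' ∈ range t | g (t' * r + y) = g (t' * r + y')}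

theorem collisions_succ (g : ℕ → ℕ) (r t y y' : ℕ) :
    collisions g r (t + 1) y y' =
      collisions g r t y y' + if g (t * r + y) = g (t * r + y') then 1 else 0 := by
  simp only [collisions, range_add_one, filter_insert]
  split_ifs <;> simp

/-- The state of the multiplicative weights method for column `y` after `t` rows: the pair
`(y, y')` has weight `2 ^ collisions` (the array `w` holds the weight minus `1`), the average weight
is at most `(1 + 1 / N) ^ t`, and the entries are below `N`. -/
structure ColumnOK (g w : ℕ → ℕ) (r N t y : ℕ) : Prop where
  weight : ∀ y' < y, w (y * r + y') + 1 = 2 ^ collisions g r t y y'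
  potential : N ^ t * ∑ y' ∈ range y, 2 ^ collisions g r t y y' ≤ y * (N + 1) ^ t
  entry_lt : ∀ t' < t, g (t' * r + y) < N

theorem ColumnOK.zero {g w : ℕ → ℕ} {r N y : ℕ} (hw : ∀ y' < y, w (y * r + y') = 0) :
    ColumnOK g w r N 0 y :=
  ⟨fun y' hy' => by simp [collisions, hw y' hy'], by simp [collisions], by simp⟩

theorem ColumnOK.congr {g g' w w' : ℕ → ℕ} {r N t y : ℕ} (h : ColumnOK g w r N t y)
    (hg : ∀ t' < t, ∀ y' ≤ y, g' (t' * r + y') = g (t' * r + y'))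
    (hw : ∀ y' < y, w' (y * r + y') = w (y * r + y')) : ColumnOK g' w' r N t y := by
  have hc : ∀ y' < y, collisions g' r t y y' = collisions g r t y y' := fun y' hy' => by
    unfold collisions
    congr 1
    refine filter_congr fun t' ht' => ?_
    rw [hg t' (mem_range.1 ht') y le_rfl, hg t' (mem_range.1 ht') y' hy'.le]
  refine ⟨fun y' hy' => by rw [hw y' hy', hc y' hy', h.weight y' hy'], ?_, fun t' ht' => ?_⟩
  · rw [sum_congr rfl fun y' hy' => by rw [hc y' (mem_range.1 hy')]]
    exact h.potential
  · rw [hg t' ht' y le_rfl]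
    exact h.entry_lt t' ht'

/-- One row of the greedy algorithm: the entry `b` is chosen so that the columns `y'` with entry `b`
have at most the average weight, and the weights of these columns are doubled. -/
theorem ColumnOK.step {g w w' : ℕ → ℕ} {r N t y b : ℕ} (h : ColumnOK g w r N t y) (hb : b < N)
    (hgb : g (t * r + y) = b)
    (hmin : N * ∑ y' ∈ range y with g (t * r + y') = b, (w (y * r + y') + 1) ≤
      ∑ y' ∈ range y, (w (y * r + y') + 1))
    (hw' : ∀ y' < y, w' (y * r + y') =
      if g (t * r + y') = b then w (y * r + y') + w (y * r + y') + 1 else w (y * r + y')) :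
    ColumnOK g w' r N (t + 1) y := by
  have hc : ∀ y' < y, 2 ^ collisions g r (t + 1) y y' =
      (w (y * r + y') + 1) + if g (t * r + y') = b then w (y * r + y') + 1 else 0 := by
    intro y' hy'
    rw [collisions_succ, pow_add, ← h.weight y' hy', hgb]
    by_cases he : g (t * r + y') = b
    · simp [he]; ring
    · simp [he, Ne.symm he]
  refine ⟨fun y' hy' => ?_, ?_, fun t' ht' => ?_⟩
  · rw [hc y' hy', hw' y' hy']
    split_ifs <;> ring
  · rw [sum_congr rfl fun y' hy' => hc y' (mem_range.1 hy'), sum_add_distrib, ← sum_filter]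
    have hp := h.potential
    rw [sum_congr rfl fun y' hy' => (h.weight y' (mem_range.1 hy')).symm] at hp
    set A := ∑ y' ∈ range y, (w (y * r + y') + 1)
    set B := ∑ y' ∈ range y with g (t * r + y') = b, (w (y * r + y') + 1)
    calc N ^ (t + 1) * (A + B) = N ^ t * (N * A + N * B) := by ring
      _ ≤ N ^ t * (N * A + A) := by gcongr
      _ = (N ^ t * A) * (N + 1) := by ring
      _ ≤ (y * (N + 1) ^ t) * (N + 1) := by gcongr
      _ = y * (N + 1) ^ (t + 1) := by ring
  · rcases Nat.lt_succ_iff_lt_or_eq.1 ht' with h' | rfl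
    · exact h.entry_lt t' h'
    · omega

theorem succ_pow_le_four_mul_pow {N : ℕ} (hN : 0 < N) : (N + 1) ^ N ≤ 4 * N ^ N := by
  have hN' : (0 : ℝ) < N := by exact_mod_cast hN
  have h : ((N : ℝ) + 1) ^ N ≤ 4 * (N : ℝ) ^ N := by
    have h1 : (1 + 1 / (N : ℝ)) ^ N ≤ Real.exp 1 := by
      calc (1 + 1 / (N : ℝ)) ^ N ≤ (Real.exp (1 / N)) ^ N := by
            gcongr
            rw [add_comm]
            exact Real.add_one_le_exp _
        _ = Real.exp 1 := by rw [← Real.exp_nat_mul]; congr 1; field_simp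
    have h2 : (1 + 1 / (N : ℝ)) ^ N ≤ 4 := h1.trans (by linarith [Real.exp_one_lt_d9])
    calc ((N : ℝ) + 1) ^ N = (1 + 1 / (N : ℝ)) ^ N * N ^ N := by
          rw [← mul_pow]; congr 1; field_simp
      _ ≤ 4 * (N : ℝ) ^ N := by gcongr
  exact_mod_cast h

/-- The total weight stays small throughout, since `(1 + 1 / N) ^ N ≤ 4`; thus the weights fit into
words. -/
theorem ColumnOK.sum_le {g w : ℕ → ℕ} {r N t y lam : ℕ} (h : ColumnOK g w r N t y) (hN : 0 < N)
    (ht : t ≤ N * lam) (hy : y ≤ 2 ^ lam) :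
    ∑ y' ∈ range y, 2 ^ collisions g r t y y' ≤ 2 ^ (3 * lam) := by
  set A := ∑ y' ∈ range y, 2 ^ collisions g r t y y'
  obtain ⟨c, hc⟩ := Nat.exists_eq_add_of_le ht
  have h1 : N ^ (N * lam) * A ≤ N ^ (N * lam) * 2 ^ (3 * lam) := by
    calc N ^ (N * lam) * A = N ^ c * (N ^ t * A) := by rw [hc]; ring
      _ ≤ (N + 1) ^ c * (y * (N + 1) ^ t) := by
          exact Nat.mul_le_mul (Nat.pow_le_pow_left (by omega) c) h.potential
      _ = y * ((N + 1) ^ N) ^ lam := by rw [← pow_mul, hc]; ring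
      _ ≤ 2 ^ lam * (4 * N ^ N) ^ lam := by gcongr; exact succ_pow_le_four_mul_pow hN
      _ = N ^ (N * lam) * 2 ^ (3 * lam) := by
          rw [mul_pow, ← pow_mul, show 4 = 2 ^ 2 by rfl, ← pow_mul]; ring
  exact Nat.le_of_mul_le_mul_left h1 (by positivity)

theorem ColumnOK.collisions_le {g w : ℕ → ℕ} {r N y y' lam : ℕ}
    (h : ColumnOK g w r N (N * lam) y) (hN : 0 < N) (hy : y ≤ 2 ^ lam) (hy' : y' < y) :
    collisions g r (N * lam) y y' ≤ 3 * lam := by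
  have h1 := (single_le_sum (f := fun y' => 2 ^ collisions g r (N * lam) y y')
    (fun _ _ => Nat.zero_le _) (mem_range.2 hy')).trans (h.sum_le hN le_rfl hy)
  exact (Nat.pow_le_pow_iff_right (by norm_num)).1 h1

end Combinatorics

/-! ### Programs for logarithms and primes

Register conventions for all programs below. Registers `0`, `1`, `2` hold `n`, `q`, `ℓ`; register `3`
is scratch space of `incr`; register `4` always holds `0`. Subprograms take arguments in registers
`5` and `6` and return a result in register `7`. The parameters of the construction are in registers
`21` (`r`), `23` (`d`), `24` (`N`), `25` (`T`), `26` (`p`), `28` (the size of the family) and `29`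
(`ℓ²`). Bank `1` is the output, bank `2` the table of first level hash values, bank `3` the matrix of
the second level, bank `4` its weights, and bank `5` holds the buckets. -/

namespace WordRAM

local infixr:65 " ;; " => Program.seq

/-- Rounded up logarithm: register `7` receives `⌈log_b x⌉`, where `x` and `b` are in registers `5`
and `6`; register `8` holds the current power of `b`. -/
def clogProg : Program :=
  .const 7 0 ;; .const 8 1 ;; forLoop 9 5 (.ite 8 5 (.arith .mul 8 8 6 ;; incr 7) .skip)

theorem clogProg_spec {W x b : ℕ} {s : State} (hx : s.reg 5 = x) (hb : s.reg 6 = b) (hb2 : 2 ≤ b)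
    (hW : x * b + x + 1 < W) :
    Exec W clogProg s (8 * x + 4) (fun s' => s'.reg 7 = Nat.clog b x) := by
  apply Exec.le
  · apply Exec.const_seq (by omega)
    apply Exec.const_seq (by omega)
    refine Exec.forLoop (N := x) (T := 5)
      (fun j s' => s'.reg 7 = min j (Nat.clog b x) ∧ s'.reg 8 = b ^ s'.reg 7)
      (by simpa using hx) (by omega) (by omega) (by decide) (by decide) (by simp) ?_ ?_
    · intro j s₁ hj hi hf ⟨h7, h8⟩
      have e5 : s₁.reg 5 = x := (hf.reg 5 rfl).trans (by simpa using hx)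
      have e6 : s₁.reg 6 = b := (hf.reg 6 rfl).trans (by simpa using hb)
      have hlt := Nat.lt_clog_iff_pow_lt (show 1 < b by omega) (x := x) (y := s₁.reg 7)
      rw [← h8] at hlt
      refine Exec.ite (T := 3) (T' := 1) (fun h => ?_) (fun h => ?_)
      · rw [e5, ← hlt] at h
        have h' := hlt.1 h
        have : s₁.reg 8 * b < x * b := by gcongr
        refine Exec.arith_seq (by simp [e6]; omega) (Exec.incr (by omega) (by decide) ?_ ?_)
        · simp; omega
        · simp [e6, h8, pow_succ]; omega
      · rw [e5, ← hlt] at h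
        refine Exec.skip ?_
        simp [h8]; omega
    · intro s₁ hf ⟨h7, h8⟩
      rw [h7]
      exact min_eq_right (Nat.clog_le_of_le_pow (Nat.lt_pow_self (by omega)).le)
  · omega

/-- Search for a prime: register `7` receives a prime number in the interval `(A, 2A]`, where `A` is
in register `5`; it exists by Bertrand's postulate. All candidates are tested, without stopping at
the first prime, so that a counting loop suffices. The candidate is in register `11`; register `12` is a flag that is cleared as soon
as a divisor is found by trial division. -/
def primeProg : Program :=
  .const 7 0 ;; move 11 5 ;; forLoop 10 5
    (incr 11 ;; .const 12 1 ;; forLoop 13 11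
        (.const 14 1 ;; .ite 14 13
          (.arith .mod 14 11 13 ;; .const 15 1 ;; .ite 14 15 (.const 12 0) .skip) .skip) ;;
      .ite 4 12 (move 7 11) .skip)

theorem primeProg_spec {W A : ℕ} {s : State} (hA : s.reg 5 = A) (h4 : s.reg 4 = 0) (hA0 : A ≠ 0)
    (hW : 2 * A + 1 < W) :
    Exec W primeProg s (A * (24 * A + 20) + 4)
      (fun s' => (s'.reg 7).Prime ∧ A < s'.reg 7 ∧ s'.reg 7 ≤ 2 * A) := by
  apply Exec.le
  · apply Exec.const_seq (by omega)
    apply Exec.arith_seq (by simp [h4, hA]; omega)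
    refine Exec.forLoop (N := A) (T := A * 24 + 17)
      (fun j s' => s'.reg 11 = A + j ∧ (∀ c, A < c → c ≤ A + j → c.Prime → s'.reg 7 ≠ 0) ∧
        (s'.reg 7 ≠ 0 → (s'.reg 7).Prime ∧ A < s'.reg 7 ∧ s'.reg 7 ≤ 2 * A))
      (by simpa using hA) (by omega) (by omega) (by decide) (by decide) ?_ ?_ ?_
    · simp [hA, h4]
      intro c _ _; omega
    · intro j s₁ hj hi hf ⟨h11, hall, hres⟩
      have e4 : s₁.reg 4 = 0 := (hf.reg 4 rfl).trans (by simpa using h4)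
      apply Exec.le
      · apply Exec.incr_seq (by omega) (by decide) (by omega)
        apply Exec.const_seq (by omega)
        refine Exec.seq (R := fun s' => s'.reg 12 =
            if ∀ d < A + j + 1, 1 < d → ¬ d ∣ A + j + 1 then 1 else 0)
          (T := (A + j + 1) * (8 + 3) + 2) (T' := 3) ?_ ?_
        · refine Exec.forLoop (fun i s' => s'.reg 12 =
              if ∀ d < i, 1 < d → ¬ d ∣ A + j + 1 then 1 else 0)
            (by simp [h11]) (by omega) (by omega) (by decide) (by decide) (by simp) ?_
            (fun s₂ _ h => h)
          intro i s₂ hi' hi2 hf2 h12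
          have e11 : s₂.reg 11 = A + j + 1 := (hf2.reg 11 rfl).trans (by simp [h11])
          have hstep : (∀ d < i + 1, 1 < d → ¬ d ∣ A + j + 1) ↔
              (∀ d < i, 1 < d → ¬ d ∣ A + j + 1) ∧ (1 < i → ¬ i ∣ A + j + 1) := by
            constructor
            · exact fun h => ⟨fun d hd => h d (by omega), h i (by omega)⟩
            · rintro ⟨h1, h2⟩ d hd
              rcases Nat.lt_succ_iff_lt_or_eq.1 hd with h | rfl
              exacts [h1 d h, h2]
          apply Exec.le
          · apply Exec.const_seq (by omega)
            apply Exec.ite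
            · intro h
              apply Exec.arith_seq
              · simp [e11]
                exact (Nat.mod_le _ _).trans_lt (by omega)
              apply Exec.const_seq (by omega)
              apply Exec.ite
              · intro h'
                simp [e11, hi2] at h h'
                refine Exec.const (by omega) ?_
                simp only [hstep]
                simp [h, Nat.dvd_of_mod_eq_zero h']
              · intro h'
                simp [e11, hi2] at h h'
                refine Exec.skip ?_
                simp only [hstep]
                have : ¬ i ∣ A + j + 1 := fun hd => h' (Nat.mod_eq_zero_of_dvd hd)
                simp [h12, this]
            · intro h
              simp [hi2] at h
              refine Exec.skip ?_
              simp only [hstep]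
              simp [h12, show ¬ 1 < i by omega]
          · omega
        · intro s₂ hf2 h12
          have e11 : s₂.reg 11 = A + j + 1 := (hf2.reg 11 rfl).trans (by simp [h11])
          have e7 : s₂.reg 7 = s₁.reg 7 := (hf2.reg 7 rfl).trans (by simp)
          have e4 : s₂.reg 4 = 0 := (hf2.reg 4 rfl).trans (by simp [e4])
          have hpr : (∀ d < A + j + 1, 1 < d → ¬ d ∣ A + j + 1) ↔ (A + j + 1).Prime := by
            rw [Nat.prime_def_lt']
            exact ⟨fun h => ⟨by omega, fun m h1 h2 => h m h2 h1⟩, fun h m h1 h2 => h.2 m h2 h1⟩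
          simp only [hpr] at h12
          refine Exec.ite (T := 1) (T' := 1) (fun h => ?_) (fun h => ?_)
          · have hp : (A + j + 1).Prime := by
              by_contra hc
              simp [hc, h12] at h
            refine Exec.arith (by simp [e11, e4]; omega) ?_
            simp [e11, e4, ← add_assoc, hp]
            omega
          · have hp : ¬ (A + j + 1).Prime := by
              intro hc
              simp [hc, h12, e4] at h
            refine Exec.skip ?_
            simp [e7, e11]
            refine ⟨by omega, fun c hc1 hc2 hc => ?_, hres⟩
            rcases Nat.lt_succ_iff_lt_or_eq.1 (Nat.lt_succ_of_le hc2) with h' | rfl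
            · exact hall c hc1 (by omega) hc
            · exact absurd hc hp
      · omega
    · intro s₁ hf ⟨_, hall, hres⟩
      obtain ⟨c, hc, h1, h2⟩ := Nat.exists_prime_lt_and_le_two_mul A hA0
      exact hres (hall c h1 (by omega) hc)
  · nlinarith

end WordRAM

/-! ### The loops of the greedy algorithm -/

namespace WordRAM

local infixr:65 " ;; " => Program.seq

open Finset

/-- Set the first `R 24` cells of bank `5` to `0`. -/
def clearLoop : Program := forLoop 33 24 (.store 5 33 42)

/-- Add up in cell `v` of bank `5` the weights of the pairs `(y, y')`, `y' < y`, for which column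
`y'` has the entry `v` in the current row. The current row of the matrix starts in bank `3` at
address `R 40`, the weights of column `y = R 31` start in bank `4` at address `R 41`. -/
def countLoop : Program :=
  forLoop 32 31 (.arith .add 43 40 32 ;; .load 44 3 43 ;; .arith .add 45 41 32 ;; .load 46 4 45 ;;
    incr 46 ;; .load 47 5 44 ;; .arith .add 47 47 46 ;; .store 5 44 47)

/-- Find a cell of bank `5` with minimal contents among the first `R 24`. -/
def argminLoop : Program :=
  .const 48 0 ;; forLoop 33 24 (.load 49 5 33 ;; .load 50 5 48 ;; .ite 49 50 (move 48 33) .skip)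

/-- Double the weights of the pairs `(y, y')` for which column `y'` has the entry `R 48` in the
current row. -/
def doubleLoop : Program :=
  forLoop 32 31 (.arith .add 43 40 32 ;; .load 44 3 43 ;; .ite 44 48 .skip (.ite 48 44 .skip
    (.arith .add 45 41 32 ;; .load 46 4 45 ;; .arith .add 46 46 46 ;; incr 46 ;; .store 4 45 46)))

theorem clearLoop_spec {W N : ℕ} {s : State} (hN : s.reg 24 = N) (h42 : s.reg 42 = 0)
    (hW : N + 1 < W) :
    Exec W clearLoop s (N * 4 + 2) (fun s' => ∀ v < N, s'.mem 5 v = 0) := by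
  refine Exec.forLoop (T := 1) (fun j s' => ∀ v < j, s'.mem 5 v = 0) hN (by omega) (by omega)
    (by decide) (by decide) (by simp) ?_ (fun _ _ h => h)
  intro j s₁ hj hi hf h
  have e42 : s₁.reg 42 = 0 := (hf.reg 42 rfl).trans h42
  refine Exec.store (by omega) (by omega) ?_
  intro v hv
  simp only [State.setReg_mem, State.setMem_mem, if_true, Function.update_apply, hi, e42]
  split_ifs with h1
  · rfl
  · exact h v (by omega)

theorem countLoop_spec {W N y a b B : ℕ} {s : State} (hy : s.reg 31 = y) (ha : s.reg 40 = a)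
    (hb : s.reg 41 = b) (h0 : ∀ v < N, s.mem 5 v = 0) (hg : ∀ y' < y, s.mem 3 (a + y') < N)
    (hB : ∑ y' ∈ range y, (s.mem 4 (b + y') + 1) ≤ B)
    (hW : B + 1 < W ∧ a + y < W ∧ b + y < W ∧ N < W) :
    Exec W countLoop s (y * 12 + 2) (fun s' => ∀ v < N, s'.mem 5 v =
      ∑ y' ∈ range y with s.mem 3 (a + y') = v, (s.mem 4 (b + y') + 1)) := by
  refine Exec.forLoop (T := 9) (fun j s' => ∀ v < N, s'.mem 5 v =
      ∑ y' ∈ range j with s.mem 3 (a + y') = v, (s.mem 4 (b + y') + 1)) hy (by omega) (by omega)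
    (by decide) (by decide) (by simpa using h0) ?_ (fun _ _ h => h)
  intro j s₁ hj hi hf h
  have e40 : s₁.reg 40 = a := (hf.reg 40 rfl).trans ha
  have e41 : s₁.reg 41 = b := (hf.reg 41 rfl).trans hb
  have m3 : s₁.mem 3 = s.mem 3 := hf.mem 3 rfl
  have m4 : s₁.mem 4 = s.mem 4 := hf.mem 4 rfl
  have hgj := hg j hj
  have hsum : ∑ y' ∈ range j with s.mem 3 (a + y') = s.mem 3 (a + j), (s.mem 4 (b + y') + 1) +
      (s.mem 4 (b + j) + 1) ≤ B := by
    refine le_trans ?_ hB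
    refine (Nat.add_le_add_right (sum_le_sum_of_subset (filter_subset _ _)) _).trans ?_
    rw [← sum_range_succ (fun y' => s.mem 4 (b + y') + 1) j]
    exact sum_le_sum_of_subset (range_subset_range.2 (by omega))
  have hc := h _ hgj
  apply Exec.arith_seq (by simp; omega)
  apply Exec.load_seq (by simp [hi, e40, m3]; omega)
  apply Exec.arith_seq (by simp; omega)
  apply Exec.load_seq (by simp [hi, e41, m4]; omega)
  apply Exec.incr_seq (by omega) (by decide) (by simp [hi, e41, m4]; omega)
  apply Exec.load_seq (by simp [hi, e40, m3]; omega)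
  apply Exec.arith_seq (by simp [hi, e40, e41, m3, m4]; omega)
  refine Exec.store (by simp [hi, e40, e41, m3, m4]; omega) (by simp [hi, e40, m3]; omega) ?_
  intro v hv
  simp only [range_add_one, filter_insert]
  by_cases hv' : s.mem 3 (a + j) = v
  · subst hv'
    rw [if_pos rfl, sum_insert (by simp)]
    simp [hi, e40, e41, m3, m4, hc]
    omega
  · simp [hi, e40, e41, m3, hv', Ne.symm hv', h v hv]

theorem argminLoop_spec {W N : ℕ} {s : State} (hN : s.reg 24 = N) (h4 : s.reg 4 = 0) (hN0 : 0 < N)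
    (hc : ∀ v < N, s.mem 5 v < W) (hW : N + 1 < W) :
    Exec W argminLoop s (N * 8 + 3)
      (fun s' => s'.reg 48 < N ∧ ∀ v < N, s.mem 5 (s'.reg 48) ≤ s.mem 5 v) := by
  apply Exec.le
  · apply Exec.const_seq (by omega)
    refine Exec.forLoop (T := 5)
      (fun j s' => s'.reg 48 < N ∧ ∀ v < j, s.mem 5 (s'.reg 48) ≤ s.mem 5 v) (by simpa using hN)
      (by omega) (by omega) (by decide) (by decide) (by simpa using hN0) ?_ (fun _ _ h => h)
    intro j s₁ hj hi hf ⟨h48, h⟩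
    have m5 : s₁.mem 5 = s.mem 5 := hf.mem 5 rfl
    have e4 : s₁.reg 4 = 0 := (hf.reg 4 rfl).trans (by simpa using h4)
    apply Exec.load_seq (by rw [m5, hi]; exact hc j hj)
    apply Exec.load_seq (by simpa [m5] using hc _ h48)
    refine Exec.ite (T := 1) (T' := 1) (fun hlt => ?_) (fun hlt => ?_)
    · simp [hi, m5] at hlt
      refine Exec.arith (by simp [hi, e4]; omega) ?_
      simp only [Op.eval, State.setReg_reg]
      simp only [hi, e4, Nat.reduceEqDiff, if_true, if_false, add_zero]
      refine ⟨hj, fun v hv => ?_⟩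
      rcases Nat.lt_succ_iff_lt_or_eq.1 hv with hv' | rfl
      · exact hlt.le.trans (h v hv')
      · exact le_rfl
    · simp [hi, m5] at hlt
      refine Exec.skip ?_
      simp only [State.setReg_reg, Nat.reduceEqDiff, if_false]
      refine ⟨h48, fun v hv => ?_⟩
      rcases Nat.lt_succ_iff_lt_or_eq.1 hv with hv' | rfl
      · exact h v hv'
      · exact hlt
  · omega

theorem doubleLoop_spec {W y a b c B : ℕ} {s : State} (hy : s.reg 31 = y) (ha : s.reg 40 = a)
    (hb : s.reg 41 = b) (hc : s.reg 48 = c) (hg : ∀ y' < y, s.mem 3 (a + y') < W)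
    (hB : ∀ y' < y, s.mem 4 (b + y') + 1 ≤ B)
    (hW : 2 * B + 1 < W ∧ a + y < W ∧ b + y < W) :
    Exec W doubleLoop s (y * 15 + 2) (fun s' => ∀ i, s'.mem 4 i =
      if b ≤ i ∧ i < b + y ∧ s.mem 3 (a + (i - b)) = c then s.mem 4 i + s.mem 4 i + 1
      else s.mem 4 i) := by
  refine Exec.forLoop (T := 12) (fun j s' => ∀ i, s'.mem 4 i =
      if b ≤ i ∧ i < b + j ∧ s.mem 3 (a + (i - b)) = c then s.mem 4 i + s.mem 4 i + 1
      else s.mem 4 i) hy (by omega) (by omega)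
    (by decide) (by decide) ?_ ?_ (fun _ _ h => h)
  · intro i
    rw [if_neg (by omega)]; rfl
  intro j s₁ hj hi hf h
  have e40 : s₁.reg 40 = a := (hf.reg 40 rfl).trans ha
  have e41 : s₁.reg 41 = b := (hf.reg 41 rfl).trans hb
  have e48 : s₁.reg 48 = c := (hf.reg 48 rfl).trans hc
  have m3 : s₁.mem 3 = s.mem 3 := hf.mem 3 rfl
  have hgj := hg j hj
  have hBj := hB j hj
  have hcur : s₁.mem 4 (b + j) = s.mem 4 (b + j) := by
    rw [h, if_neg (by omega)]
  have hskip : s.mem 3 (a + j) ≠ c → ∀ i, s₁.mem 4 i =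
      if b ≤ i ∧ i < b + (j + 1) ∧ s.mem 3 (a + (i - b)) = c then s.mem 4 i + s.mem 4 i + 1
      else s.mem 4 i := by
    intro hne i
    rw [h i]
    refine if_congr ?_ rfl rfl
    constructor
    · rintro ⟨h1, h2, h3⟩; exact ⟨h1, by omega, h3⟩
    · rintro ⟨h1, h2, h3⟩
      refine ⟨h1, ?_, h3⟩
      by_contra h4
      obtain rfl : i = b + j := by omega
      exact hne (by simpa using h3)
  apply Exec.le
  · apply Exec.arith_seq (by simp; omega)
    apply Exec.load_seq (by simpa [hi, e40, m3] using hgj)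
    apply Exec.ite
    · intro hlt
      simp [hi, e40, e48, m3] at hlt
      exact Exec.skip (by simpa using hskip hlt.ne)
    · intro hlt
      apply Exec.ite
      · intro hlt'
        simp [hi, e40, e48, m3] at hlt'
        exact Exec.skip (by simpa using hskip hlt'.ne')
      · intro hlt'
        simp [hi, e40, e48, m3] at hlt hlt'
        have heq : s.mem 3 (a + j) = c := le_antisymm hlt' hlt
        apply Exec.arith_seq (by simp; omega)
        apply Exec.load_seq (by simp [hi, e41, hcur]; omega)
        apply Exec.arith_seq (by simp [hi, e41, hcur]; omega)
        apply Exec.incr_seq (by omega) (by decide) (by simp [hi, e41, hcur]; omega)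
        refine Exec.store (by simp [hi, e41, hcur]; omega) (by simp [hi, e41]; omega) ?_
        intro i
        simp only [State.setReg_mem, State.setMem_mem, if_true, Function.update_apply]
        by_cases hib : i = b + j
        · subst hib
          simp [hi, e41, hcur, heq]
        · rw [if_neg (by simpa [hi, e41] using hib), h i]
          refine if_congr ?_ rfl rfl
          constructor
          · rintro ⟨h1, h2, h3⟩; exact ⟨h1, by omega, h3⟩
          · rintro ⟨h1, h2, h3⟩; exact ⟨h1, by omega, h3⟩
  · omega

end WordRAM

/-! ### The greedy algorithm -/

namespace WordRAM

local infixr:65 " ;; " => Program.seq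

open Finset

/-- Choose the entry of column `R 31` in row `R 30`, and update the weights. -/
def columnStep : Program :=
  .arith .mul 41 31 21 ;; .const 42 0 ;; clearLoop ;; countLoop ;; argminLoop ;;
    .arith .add 43 40 31 ;; .store 3 43 48 ;; doubleLoop

/-- Build the matrix of the second hashing level, with `R 25` rows, `R 21` columns and entries below
`R 24`, in bank `3`, row by row, by the method of multiplicative weights. -/
def greedyProg : Program :=
  forLoop 30 25 (.arith .mul 40 30 21 ;; forLoop 31 21 columnStep)

/-- The matrix is complete up to row `t`, and row `t` is complete up to column `y`. -/
def GreedyInv (r N t y : ℕ) (s : State) : Prop :=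
  ∀ y₁ < r, ColumnOK (s.mem 3) (s.mem 4) r N (if y₁ < y then t + 1 else t) y₁

theorem columnStep_spec {W r N t y lam : ℕ} {s : State} (h21 : s.reg 21 = r) (h24 : s.reg 24 = N)
    (h40 : s.reg 40 = t * r) (h31 : s.reg 31 = y) (h4 : s.reg 4 = 0) (hN : 0 < N) (hy : y < r)
    (hr : r ≤ 2 ^ lam) (ht : t < N * lam) (hinv : GreedyInv r N t y s)
    (hW : 2 * 2 ^ (3 * lam) + 1 < W ∧ N * lam * r + r < W ∧ r * r + r < W ∧ N + 1 < W) :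
    Exec W columnStep s (12 * N + 27 * r + 15) (GreedyInv r N t (y + 1)) := by
  obtain ⟨hW1, hW2, hW3, hW4⟩ := hW
  have hcol := hinv y hy
  rw [if_neg (lt_irrefl y)] at hcol
  have htr : t * r + r ≤ N * lam * r := by
    rw [← Nat.succ_mul]; exact Nat.mul_le_mul_right _ ht
  have hyr : y * r + r ≤ r * r := by
    rw [← Nat.succ_mul]; exact Nat.mul_le_mul_right _ hy
  have hB := hcol.sum_le hN ht.le (hy.le.trans hr)
  rw [sum_congr rfl fun y' hy' => (hcol.weight y' (mem_range.1 hy')).symm] at hB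
  have hg : ∀ y' < y, s.mem 3 (t * r + y') < N := fun y' hy' => by
    have := hinv y' (hy'.trans hy)
    rw [if_pos hy'] at this
    exact this.entry_lt t (by omega)
  have hpos : 0 < 2 ^ (3 * lam) := by positivity
  apply Exec.le
  · apply Exec.arith_seq (by simp [h31, h21]; omega)
    apply Exec.const_seq (by omega)
    refine Exec.seq (clearLoop_spec (N := N) (by simpa using h24) (by simp) (by omega))
      (T' := N * 8 + 27 * r + 11) ?_
    intro s₁ hf₁ h₁
    have e31 : s₁.reg 31 = y := (hf₁.reg 31 rfl).trans (by simpa using h31)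
    have e40 : s₁.reg 40 = t * r := (hf₁.reg 40 rfl).trans (by simpa using h40)
    have e41 : s₁.reg 41 = y * r := (hf₁.reg 41 rfl).trans (by simp [h31, h21])
    have e24 : s₁.reg 24 = N := (hf₁.reg 24 rfl).trans (by simpa using h24)
    have e4 : s₁.reg 4 = 0 := (hf₁.reg 4 rfl).trans (by simpa using h4)
    have m3 : s₁.mem 3 = s.mem 3 := hf₁.mem 3 rfl
    have m4 : s₁.mem 4 = s.mem 4 := hf₁.mem 4 rfl
    apply Exec.le
    · refine Exec.seq (countLoop_spec (N := N) (B := 2 ^ (3 * lam)) e31 e40 e41 h₁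
        (by rwa [m3]) (by rwa [m4]) (by omega)) (T' := N * 8 + 15 * r + 8) ?_
      intro s₂ hf₂ h₂
      rw [m3, m4] at h₂
      have e31 : s₂.reg 31 = y := (hf₂.reg 31 rfl).trans e31
      have e40 : s₂.reg 40 = t * r := (hf₂.reg 40 rfl).trans e40
      have e41 : s₂.reg 41 = y * r := (hf₂.reg 41 rfl).trans e41
      have e24 : s₂.reg 24 = N := (hf₂.reg 24 rfl).trans e24
      have e4 : s₂.reg 4 = 0 := (hf₂.reg 4 rfl).trans e4
      have m3 : s₂.mem 3 = s.mem 3 := (hf₂.mem 3 rfl).trans m3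
      have m4 : s₂.mem 4 = s.mem 4 := (hf₂.mem 4 rfl).trans m4
      apply Exec.le
      · refine Exec.seq (argminLoop_spec (N := N) e24 e4 hN (fun v hv => ?_) (by omega))
          (T' := 15 * r + 5) ?_
        · rw [h₂ v hv]
          exact (sum_le_sum_of_subset (filter_subset _ _)).trans_lt (by omega)
        intro s₃ hf₃ ⟨hb, hmin⟩
        have e31 : s₃.reg 31 = y := (hf₃.reg 31 rfl).trans e31
        have e40 : s₃.reg 40 = t * r := (hf₃.reg 40 rfl).trans e40
        have e41 : s₃.reg 41 = y * r := (hf₃.reg 41 rfl).trans e41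
        have m3 : s₃.mem 3 = s.mem 3 := (hf₃.mem 3 rfl).trans m3
        have m4 : s₃.mem 4 = s.mem 4 := (hf₃.mem 4 rfl).trans m4
        generalize hbdef : s₃.reg 48 = b at hb hmin
        apply Exec.le
        · apply Exec.arith_seq (by simp [e40, e31]; omega)
          apply Exec.store_seq (by simp [hbdef]; omega) (by simp [e40, e31]; omega)
          refine Exec.imp (doubleLoop_spec (y := y) (a := t * r) (b := y * r) (c := b)
            (B := 2 ^ (3 * lam)) (by simpa using e31) (by simpa using e40) (by simpa using e41)
            (by simpa using hbdef) ?_ ?_ (by omega)) ?_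
          · intro y' hy'
            have := hg y' hy'
            simp [e40, e31, m3, hy'.ne]
            omega
          · intro y' hy'
            have h1 := single_le_sum (f := fun y' => s.mem 4 (y * r + y') + 1)
              (fun _ _ => Nat.zero_le _) (mem_range.2 hy')
            simp [m4]
            omega
          · intro s₄ hf₄ h₄
            have m3' : s₄.mem 3 = Function.update (s.mem 3) (t * r + y) b :=
              (hf₄.mem 3 rfl).trans (by simp [e40, e31, hbdef, m3])
            simp only [State.setMem_mem, State.setReg_mem, m4, m3, e40, e31, hbdef,
              State.setReg_reg, Op.eval, Nat.reduceEqDiff, if_true, if_false] at h₄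
            have hsame : ∀ t' y', t' * r + y' ≠ t * r + y →
                s₄.mem 3 (t' * r + y') = s.mem 3 (t' * r + y') := fun t' y' hne => by
              rw [m3', Function.update_of_ne hne]
            have hrow : ∀ t' < t, ∀ y' < r, t' * r + y' ≠ t * r + y := fun t' ht' y' hy' => by
              have : t' * r + r ≤ t * r := by
                rw [← Nat.succ_mul]; exact Nat.mul_le_mul_right _ ht'
              omega
            -- the weights of the other columns are stored elsewhere
            have hother : ∀ y₁ ≠ y, ∀ y' < y₁, y₁ < r →
                s₄.mem 4 (y₁ * r + y') = s.mem 4 (y₁ * r + y') := by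
              intro y₁ hne y' hy' hy₁
              rw [h₄, if_neg]
              rintro ⟨h1, h2, -⟩
              rcases Nat.lt_or_gt_of_ne hne with h | h
              · have : y₁ * r + r ≤ y * r := by
                  rw [← Nat.succ_mul]; exact Nat.mul_le_mul_right _ h
                omega
              · have : y * r + r ≤ y₁ * r := by
                  rw [← Nat.succ_mul]; exact Nat.mul_le_mul_right _ h
                omega
            intro y₁ hy₁
            rcases lt_trichotomy y₁ y with h | rfl | h
            · have hc := hinv y₁ hy₁
              rw [if_pos h] at hc
              rw [if_pos (by omega)]
              refine hc.congr (fun t' ht' y' hy' => hsame t' y' ?_) fun y' hy' =>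
                hother y₁ h.ne y' hy' hy₁
              rcases Nat.lt_succ_iff_lt_or_eq.1 ht' with h' | rfl
              · exact hrow t' h' y' (by omega)
              · omega
            · rw [if_pos (by omega)]
              have hc : ColumnOK (s₄.mem 3) (s.mem 4) r N t y₁ := hcol.congr
                (fun t' ht' y' hy' => hsame t' y' (hrow t' ht' y' (by omega))) fun _ _ => rfl
              have hcur : ∀ y' < y₁, s₄.mem 3 (t * r + y') = s.mem 3 (t * r + y') :=
                fun y' hy' => hsame t y' (by omega)
              refine hc.step hb (by rw [m3']; simp) ?_ ?_
              · -- the least loaded of the `N` buckets has at most the average weight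
                have e1 : ∀ v, ({y' ∈ range y₁ | s₄.mem 3 (t * r + y') = v} : Finset ℕ) =
                    {y' ∈ range y₁ | s.mem 3 (t * r + y') = v} := fun v =>
                  filter_congr fun y' hy' => by rw [hcur y' (mem_range.1 hy')]
                rw [e1]
                rw [h₂ b hb] at hmin
                rw [← sum_fiberwise_of_maps_to (s := range y₁) (t := range N)
                  (g := fun y' => s.mem 3 (t * r + y'))
                  (fun y' hy' => mem_range.2 (hg y' (mem_range.1 hy')))
                  (fun y' => s.mem 4 (y₁ * r + y') + 1)]
                have := card_nsmul_le_sum (range N) (fun v =>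
                  ∑ y' ∈ range y₁ with s.mem 3 (t * r + y') = v, (s.mem 4 (y₁ * r + y') + 1)) _
                  fun v hv => by
                    have := hmin v (mem_range.1 hv)
                    rwa [h₂ v (mem_range.1 hv)] at this
                simpa using this
              · intro y' hy'
                rw [h₄, hcur y' hy']
                refine if_congr ?_ rfl rfl
                rw [Nat.add_sub_cancel_left, Function.update_of_ne (by omega)]
                exact ⟨fun h => h.2.2, fun h => ⟨by omega, by omega, h⟩⟩
            · have hc := hinv y₁ hy₁
              rw [if_neg (by omega)] at hc
              rw [if_neg (by omega)]
              exact hc.congr (fun t' ht' y' hy' => hsame t' y' (hrow t' ht' y' (by omega)))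
                fun y' hy' => hother y₁ h.ne' y' hy' hy₁
        · omega
      · omega
    · omega
  · omega

theorem greedyProg_spec {W r N lam : ℕ} {s : State} (h21 : s.reg 21 = r) (h24 : s.reg 24 = N)
    (h25 : s.reg 25 = N * lam) (h4 : s.reg 4 = 0) (hN : 0 < N) (hr : r ≤ 2 ^ lam)
    (hmem : ∀ i, s.mem 4 i = 0)
    (hW : 2 * 2 ^ (3 * lam) + 1 < W ∧ N * lam * r + r < W ∧ r * r + r < W ∧ N * lam + N + 1 < W) :
    Exec W greedyProg s (N * lam * (r * (12 * N + 27 * r + 18) + 6) + 2)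
      (fun s' => ∀ y < r, (∀ t < N * lam, s'.mem 3 (t * r + y) < N) ∧
        ∀ y' < r, y ≠ y' → collisions (s'.mem 3) r (N * lam) y y' ≤ 3 * lam) := by
  obtain ⟨hW1, hW2, hW3, hW4⟩ := hW
  have hpos : 0 < 2 ^ (3 * lam) := by positivity
  refine Exec.forLoop (T := r * (12 * N + 27 * r + 18) + 3) (fun t s' => GreedyInv r N t 0 s')
    h25 (by omega) (by omega) (by decide) (by decide) ?_ ?_ ?_
  · intro y₁ _
    rw [if_neg (by omega)]
    exact ColumnOK.zero fun y' _ => hmem _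
  · intro t s₁ ht hi hf hinv
    have e21 : s₁.reg 21 = r := (hf.reg 21 rfl).trans h21
    have e24 : s₁.reg 24 = N := (hf.reg 24 rfl).trans h24
    have e4 : s₁.reg 4 = 0 := (hf.reg 4 rfl).trans h4
    have htr : t * r + r ≤ N * lam * r := by
      rw [← Nat.succ_mul]; exact Nat.mul_le_mul_right _ ht
    apply Exec.arith_seq (by simp [hi, e21]; omega)
    refine Exec.forLoop (N := r) (T := 12 * N + 27 * r + 15) (fun y s' => GreedyInv r N t y s')
      (by simpa using e21) (by omega) (by omega) (by decide) (by decide) hinv ?_ ?_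
    · intro y s₂ hy hi₂ hf₂ hinv₂
      exact columnStep_spec ((hf₂.reg 21 rfl).trans (by simpa using e21))
        ((hf₂.reg 24 rfl).trans (by simpa using e24))
        ((hf₂.reg 40 rfl).trans (by simp [hi, e21])) hi₂
        ((hf₂.reg 4 rfl).trans (by simpa using e4)) hN hy hr ht hinv₂ (by omega)
    · intro s₂ _ hinv₂ y₁ hy₁
      have := hinv₂ y₁ hy₁
      rw [if_pos hy₁] at this
      rw [if_neg (by omega)]
      exact this
  · intro s₁ _ hinv y hy
    have hcol : ∀ y < r, ColumnOK (s₁.mem 3) (s₁.mem 4) r N (N * lam) y := fun y hy => by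
      have := hinv y hy
      rwa [if_neg (by omega)] at this
    refine ⟨(hcol y hy).entry_lt, fun y' hy' hne => ?_⟩
    rcases Nat.lt_or_gt_of_ne hne with h | h
    · have := (hcol y' hy').collisions_le hN (hy'.le.trans hr) h
      simpa only [collisions, eq_comm] using this
    · exact (hcol y hy).collisions_le hN (hy.le.trans hr) h

end WordRAM

/-! ### Writing the value tables -/

namespace WordRAM

local infixr:65 " ;; " => Program.seq

open Finset

/-- The colour of `u` under the composition of the three levels: the Reed–Solomon hash function with
parameter `a`, row `t` of the matrix `g`, and the colouring with parameters `x` and `y`. -/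
def levelColour (g : ℕ → ℕ) (q r p a t x y u : ℕ) : ℕ :=
  y * x ^ g (t * r + rsHash r a u) % p * q / p

/-- Member `j` of the family; the parameters `a`, `t`, `x`, `y` are the digits of `j` in the mixed
radix system with bases `T`, `p`, `p`. -/
def familyColour (g : ℕ → ℕ) (q r T p j u : ℕ) : ℕ :=
  levelColour g q r p (j / p / p / T) (j / p / p % T) (j / p % p) (j % p) u

theorem levelColour_lt {g : ℕ → ℕ} {q r p a t x y u : ℕ} (hp : 0 < p) (hq : 0 < q) :
    levelColour g q r p a t x y u < q := by
  refine Nat.div_lt_of_lt_mul ?_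
  have := Nat.mod_lt (y * x ^ g (t * r + rsHash r a u)) hp
  gcongr

/-- Register `63` receives `y * x ^ R 62 % p`, where `x` is in register `52`, `p` in register `26`,
and register `63` initially holds `y`. -/
def powerLoop : Program := forLoop 64 62 (.arith .mul 63 63 52 ;; .arith .mod 63 63 26)

/-- Colour the element `R 58`: bank `2` is a table of its hash values at the first level, which is
filled by Horner's rule from the value at the quotient by `r = R 21`. -/
def colourStep : Program :=
  .arith .div 59 58 21 ;; .load 60 2 59 ;; .arith .mul 60 60 55 ;; .arith .mod 61 58 21 ;;
    .arith .add 60 60 61 ;; .arith .mod 60 60 21 ;; .store 2 58 60 ;; .arith .add 61 56 60 ;;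
    .load 62 3 61 ;; move 63 51 ;; powerLoop ;; .arith .mul 63 63 1 ;; .arith .div 63 63 26 ;;
    .arith .add 61 57 58 ;; .store 1 61 63

/-- Write the value tables of the `R 28` members of the family to bank `1`. -/
def outputProg : Program :=
  forLoop 50 28 (.arith .mod 51 50 26 ;; .arith .div 53 50 26 ;; .arith .mod 52 53 26 ;;
    .arith .div 53 53 26 ;; .arith .mod 54 53 25 ;; .arith .div 55 53 25 ;;
    .arith .mul 56 54 21 ;; .arith .mul 57 50 0 ;; forLoop 58 0 colourStep)

theorem powerLoop_spec {W p x y N : ℕ} {s : State} (hN : s.reg 62 = N) (hx : s.reg 52 = x)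
    (hp : s.reg 26 = p) (hy : s.reg 63 = y) (hxp : x < p) (hyp : y < p)
    (hW : N + 1 < W ∧ p * p < W) :
    Exec W powerLoop s (N * 5 + 2) (fun s' => s'.reg 63 = y * x ^ N % p) := by
  refine Exec.forLoop (T := 2) (fun j s' => s'.reg 63 = y * x ^ j % p) hN (by omega) (by omega)
    (by decide) (by decide) (by simp [hy, Nat.mod_eq_of_lt hyp]) ?_ (fun _ _ h => h)
  intro j s₁ hj hi hf h
  have e52 : s₁.reg 52 = x := (hf.reg 52 rfl).trans hx
  have e26 : s₁.reg 26 = p := (hf.reg 26 rfl).trans hp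
  have hlt : s₁.reg 63 < p := h ▸ Nat.mod_lt _ (by omega)
  have h1 : s₁.reg 63 * x < p * p := Nat.mul_lt_mul'' hlt hxp
  apply Exec.arith_seq (by simp [e52]; omega)
  refine Exec.arith (by simp [e52]; exact (Nat.mod_le _ _).trans_lt (by omega)) ?_
  simp [e52, e26, h, pow_succ, ← mul_assoc]

theorem colourStep_spec {W n q r p a t x y u c N : ℕ} {s : State} (hu : s.reg 58 = u)
    (h4 : s.reg 4 = 0) (h1 : s.reg 1 = q) (h21 : s.reg 21 = r) (h26 : s.reg 26 = p)
    (h51 : s.reg 51 = y) (h52 : s.reg 52 = x) (h55 : s.reg 55 = a) (h56 : s.reg 56 = t * r)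
    (h57 : s.reg 57 = c) (hr : 2 ≤ r) (hyp : y < p) (hxp : x < p) (ha : a < r) (hun : u < n)
    (h2 : s.mem 2 (u / r) = rsHash r a (u / r)) (hg : ∀ z < r, s.mem 3 (t * r + z) < N)
    (hW : n < W ∧ r * r + r < W ∧ t * r + r < W ∧ N + 1 < W ∧ p * p < W ∧ p * q < W ∧ c + n < W) :
    Exec W colourStep s (5 * N + 20) (fun s' =>
      s'.mem 2 = Function.update (s.mem 2) u (rsHash r a u) ∧
      s'.mem 1 = Function.update (s.mem 1) (c + u)
        (levelColour (s.mem 3) q r p a t x y u)) := by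
  obtain ⟨hW1, hW2, hW3, hW4, hW5, hW6, hW7⟩ := hW
  have hr0 : 0 < r := by omega
  have hlt := rsHash_lt hr0 a (u / r)
  have hprod : rsHash r a (u / r) * a < r * r := Nat.mul_lt_mul'' hlt ha
  have hmod := Nat.mod_lt u hr0
  have hrec := (rsHash_eq hr a u).symm
  have hlt' := rsHash_lt hr0 a u
  have hgz := hg _ hlt'
  apply Exec.le
  · apply Exec.arith_seq (by simp [hu, h21]; exact (Nat.div_le_self _ _).trans_lt (by omega))
    apply Exec.load_seq (by simp [hu, h21, h2]; omega)
    apply Exec.arith_seq (by simp [hu, h21, h2, h55]; omega)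
    apply Exec.arith_seq (by simp [hu, h21]; omega)
    apply Exec.arith_seq (by simp [hu, h21, h2, h55]; omega)
    apply Exec.arith_seq (by simp [hu, h21, h2, h55, hrec]; omega)
    apply Exec.store_seq (by simp [hu, h21, h2, h55, hrec]; omega) (by simp [hu]; omega)
    apply Exec.arith_seq (by simp [hu, h21, h2, h55, hrec, h56]; omega)
    apply Exec.load_seq (by simp [hu, h21, h2, h55, hrec, h56]; omega)
    have hpp : p ≤ p * p := Nat.le_mul_self p
    apply Exec.arith_seq (by simp [h4, h51]; omega)
    refine Exec.seq (powerLoop_spec (N := s.mem 3 (t * r + rsHash r a u)) (p := p) (x := x)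
      (y := y) (by simp [hu, h21, h2, h55, hrec, h56]) (by simp [h52]) (by simp [h26])
      (by simp [h51, h4]) hxp hyp (by omega)) (T' := 4) ?_
    intro s₁ hf h63
    have e58 : s₁.reg 58 = u := (hf.reg 58 rfl).trans (by simpa using hu)
    have e57 : s₁.reg 57 = c := (hf.reg 57 rfl).trans (by simpa using h57)
    have e26 : s₁.reg 26 = p := (hf.reg 26 rfl).trans (by simpa using h26)
    have e1 : s₁.reg 1 = q := (hf.reg 1 rfl).trans (by simpa using h1)
    have m2 : s₁.mem 2 = Function.update (s.mem 2) u (rsHash r a u) :=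
      (hf.mem 2 rfl).trans (by simp [hu, h21, h2, h55, hrec])
    have m1 : s₁.mem 1 = s.mem 1 := (hf.mem 1 rfl).trans (by simp)
    have hlt63 := Nat.mod_lt (y * x ^ s.mem 3 (t * r + rsHash r a u)) (show 0 < p by omega)
    rw [← h63] at hlt63
    have hq : s₁.reg 63 * q ≤ p * q := Nat.mul_le_mul_right _ hlt63.le
    apply Exec.arith_seq (by simp [e1]; omega)
    apply Exec.arith_seq (by simp [e1]; exact (Nat.div_le_self _ _).trans_lt (by omega))
    apply Exec.arith_seq (by simp [e57, e58]; omega)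
    refine Exec.store (by simp [e1]; exact (Nat.div_le_self _ _).trans_lt (by omega))
      (by simp [e57, e58]; omega) ?_
    simp [m2, m1, e57, e58, e1, e26, h63, levelColour]
  · omega

theorem outputProg_spec {W n q r p T N m : ℕ} {s : State} (h0 : s.reg 0 = n) (h1 : s.reg 1 = q)
    (h4 : s.reg 4 = 0) (h21 : s.reg 21 = r) (h25 : s.reg 25 = T) (h26 : s.reg 26 = p)
    (h28 : s.reg 28 = m) (hr : 2 ≤ r) (hp : 0 < p) (hT : 0 < T) (hm : m ≤ r * T * p * p)
    (hg : ∀ t < T, ∀ z < r, s.mem 3 (t * r + z) < N) (h2 : ∀ i, s.mem 2 i = 0)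
    (hW : n < W ∧ r * r + r < W ∧ T * r + r < W ∧ N + 1 < W ∧ p * p < W ∧ p * q < W ∧
      m * n + m + n < W) :
    Exec W outputProg s (m * (n * (5 * N + 23) + 13) + 2)
      (fun s' => ∀ j < m, ∀ u < n, s'.mem 1 (j * n + u) = familyColour (s.mem 3) q r T p j u) := by
  obtain ⟨hW1, hW2, hW3, hW4, hW5, hW6, hW7⟩ := hW
  refine Exec.forLoop (T := n * (5 * N + 23) + 10) (fun j s' => s'.mem 2 0 = 0 ∧
      ∀ j' < j, ∀ u < n, s'.mem 1 (j' * n + u) = familyColour (s.mem 3) q r T p j' u)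
    h28 (by omega) (by omega) (by decide) (by decide) (by simp [h2]) ?_ (fun _ _ h => h.2)
  intro j s₁ hj hi hf ⟨hz, hprev⟩
  have e0 : s₁.reg 0 = n := (hf.reg 0 rfl).trans h0
  have e1 : s₁.reg 1 = q := (hf.reg 1 rfl).trans h1
  have e4 : s₁.reg 4 = 0 := (hf.reg 4 rfl).trans h4
  have e21 : s₁.reg 21 = r := (hf.reg 21 rfl).trans h21
  have e25 : s₁.reg 25 = T := (hf.reg 25 rfl).trans h25
  have e26 : s₁.reg 26 = p := (hf.reg 26 rfl).trans h26
  have m3 : s₁.mem 3 = s.mem 3 := hf.mem 3 rfl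
  have hjW : j < W := by omega
  have ha : j / p / p / T < r := by
    rw [Nat.div_div_eq_div_mul, Nat.div_div_eq_div_mul]
    refine Nat.div_lt_of_lt_mul (hj.trans_le (hm.trans (le_of_eq ?_)))
    ring
  have ht : j / p / p % T < T := Nat.mod_lt _ hT
  have hx : j / p % p < p := Nat.mod_lt _ hp
  have hy : j % p < p := Nat.mod_lt _ hp
  have hjp : j / p ≤ j := Nat.div_le_self _ _
  have hjpp : j / p / p ≤ j / p := Nat.div_le_self _ _
  have hjppT : j / p / p / T ≤ j / p / p := Nat.div_le_self _ _
  have hpp : p ≤ p * p := Nat.le_mul_self p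
  have htr : j / p / p % T * r + r ≤ T * r := by
    rw [← Nat.succ_mul]; exact Nat.mul_le_mul_right _ ht
  have hjn : j * n + n ≤ m * n := by
    rw [← Nat.succ_mul]; exact Nat.mul_le_mul_right _ hj
  have hTr : T ≤ T * r := Nat.le_mul_of_pos_right _ (by omega)
  apply Exec.arith_seq (by simp [hi, e26]; omega)
  apply Exec.arith_seq (by simp [hi, e26]; omega)
  apply Exec.arith_seq (by simp [hi, e26]; omega)
  apply Exec.arith_seq (by simp [hi, e26]; omega)
  apply Exec.arith_seq (by simp [hi, e26, e25]; omega)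
  apply Exec.arith_seq (by simp [hi, e26, e25]; omega)
  apply Exec.arith_seq (by simp [hi, e26, e25, e21]; omega)
  apply Exec.arith_seq (by simp [hi, e0]; omega)
  refine Exec.forLoop (N := n) (T := 5 * N + 20) (fun u s' => s'.mem 2 0 = 0 ∧
      (∀ u' < u, s'.mem 2 u' = rsHash r (j / p / p / T) u') ∧
      (∀ j' < j, ∀ u < n, s'.mem 1 (j' * n + u) = familyColour (s.mem 3) q r T p j' u) ∧
      ∀ u' < u, s'.mem 1 (j * n + u') = familyColour (s.mem 3) q r T p j u')
    (by simpa using e0) (by omega) (by omega) (by decide) (by decide) ?_ ?_ ?_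
  · exact ⟨by simpa using hz, by simp, by simpa using hprev, by simp⟩
  · intro u s₂ hu hi₂ hf₂ ⟨hz₂, hh, hprev₂, hcur⟩
    have m3' : s₂.mem 3 = s.mem 3 := (hf₂.mem 3 rfl).trans (by simpa using m3)
    have hdiv : s₂.mem 2 (u / r) = rsHash r (j / p / p / T) (u / r) := by
      rcases Nat.eq_zero_or_pos u with rfl | hpos
      · simpa [rsHash_zero] using hz₂
      · exact hh _ (Nat.div_lt_self hpos hr)
    refine Exec.imp (colourStep_spec (n := n) (q := q) (r := r) (p := p) (a := j / p / p / T)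
      (t := j / p / p % T) (x := j / p % p) (y := j % p) (u := u) (c := j * n) (N := N) hi₂
      ((hf₂.reg 4 rfl).trans (by simpa using e4)) ((hf₂.reg 1 rfl).trans (by simpa using e1))
      ((hf₂.reg 21 rfl).trans (by simpa using e21)) ((hf₂.reg 26 rfl).trans (by simpa using e26))
      ((hf₂.reg 51 rfl).trans (by simp [hi, e26])) ((hf₂.reg 52 rfl).trans (by simp [hi, e26]))
      ((hf₂.reg 55 rfl).trans (by simp [hi, e26, e25]))
      ((hf₂.reg 56 rfl).trans (by simp [hi, e26, e25, e21]))
      ((hf₂.reg 57 rfl).trans (by simp [hi, e0])) hr hy hx ha hu hdiv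
      (by rw [m3']; exact hg _ ht) (by omega)) ?_
    rintro s₃ _ ⟨h₂, h₁⟩
    simp only [State.setReg_mem, h₂, h₁, m3']
    refine ⟨?_, fun u' hu' => ?_, fun j' hj' u' hu' => ?_, fun u' hu' => ?_⟩
    · rcases Nat.eq_zero_or_pos u with rfl | hpos
      · simp [rsHash_zero]
      · rw [Function.update_of_ne (by omega), hz₂]
    · rcases Nat.lt_succ_iff_lt_or_eq.1 hu' with h | rfl
      · rw [Function.update_of_ne (by omega), hh u' h]
      · simp
    · have : j' * n + n ≤ j * n := by
        rw [← Nat.succ_mul]; exact Nat.mul_le_mul_right _ hj'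
      rw [Function.update_of_ne (by omega), hprev₂ j' hj' u' hu']
    · rcases Nat.lt_succ_iff_lt_or_eq.1 hu' with h | rfl
      · rw [Function.update_of_ne (by omega), hcur u' h]
      · simp [familyColour]
  · rintro s₂ _ ⟨hz₂, _, hprev₂, hcur⟩
    refine ⟨by simpa using hz₂, fun j' hj' u hu => ?_⟩
    rcases Nat.lt_succ_iff_lt_or_eq.1 hj' with h | rfl
    · simpa using hprev₂ j' h u hu
    · simpa using hcur u hu

end WordRAM

/-! ### The program and its parameters -/

namespace WordRAM

local infixr:65 " ;; " => Program.seq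

open Finset

/-- Registers `29` and `21` receive `ℓ²` and a prime number `r > ℓ² ⌈log₂ n⌉`. -/
def firstPrimeProg : Program :=
  move 5 0 ;; .const 6 2 ;; clogProg ;; .arith .mul 29 2 2 ;; .arith .mul 5 29 7 ;; primeProg ;;
    move 21 7

/-- Registers `23`, `24` and `25` receive the number `d` of base-`r` digits, the size `N = 3 ℓ²` of
the range of the second level, and its number `T = N ⌈log₂ (r + 1)⌉` of functions. -/
def sizesProg : Program :=
  move 5 0 ;; move 6 21 ;; clogProg ;; move 23 7 ;; move 5 21 ;; incr 5 ;; .const 6 2 ;; clogProg ;;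
    .const 24 3 ;; .arith .mul 24 24 29 ;; .arith .mul 25 24 7

/-- Registers `26` and `28` receive a prime number `p > N (4 q) ^ ℓ` and the size `ℓ² d T p²` of the
family. -/
def secondPrimeProg : Program :=
  move 5 24 ;; .const 16 4 ;; .arith .mul 16 16 1 ;; forLoop 17 2 (.arith .mul 5 5 16) ;;
    primeProg ;; move 26 7 ;; .arith .mul 28 29 23 ;; .arith .mul 28 28 25 ;;
    .arith .mul 28 28 26 ;; .arith .mul 28 28 26

/-- The construction for `q ≥ 2` and `ℓ ≥ 1`. -/
def familyProg : Program :=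
  firstPrimeProg ;; sizesProg ;; secondPrimeProg ;; greedyProg ;; outputProg ;; move 0 28

/-- The whole program. If `q = 1` or `ℓ = 0`, a single function suffices, and the output bank already
holds the table of the constant function `0`. -/
def mainProg : Program :=
  .const 20 1 ;; .ite 20 1 (.ite 4 2 familyProg (.const 0 1)) (.const 0 1)

theorem firstPrimeProg_spec {W n ℓ : ℕ} {s : State} (h0 : s.reg 0 = n) (h2 : s.reg 2 = ℓ)
    (h4 : s.reg 4 = 0) (hn : 2 ≤ n) (hℓ : 1 ≤ ℓ)
    (hW : n * 2 + n + 1 < W ∧ 2 * (ℓ * ℓ * Nat.clog 2 n) + 1 < W) :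
    Exec W firstPrimeProg s
      (8 * n + (ℓ * ℓ * Nat.clog 2 n) * (24 * (ℓ * ℓ * Nat.clog 2 n) + 20) + 13)
      (fun s' => s'.reg 29 = ℓ * ℓ ∧ (s'.reg 21).Prime ∧ ℓ * ℓ * Nat.clog 2 n < s'.reg 21 ∧
        s'.reg 21 ≤ 2 * (ℓ * ℓ * Nat.clog 2 n)) := by
  obtain ⟨hW1, hW2⟩ := hW
  have hL : 0 < Nat.clog 2 n := Nat.clog_pos (by norm_num) hn
  have hA : 0 < ℓ * ℓ * Nat.clog 2 n := by positivity
  have hll : ℓ * ℓ ≤ ℓ * ℓ * Nat.clog 2 n := Nat.le_mul_of_pos_right _ hL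
  apply Exec.le
  · apply Exec.arith_seq (by simp [h0, h4]; omega)
    apply Exec.const_seq (by omega)
    refine Exec.seq (clogProg_spec (x := n) (b := 2) (by simp [h0, h4]) (by simp) le_rfl hW1)
      (T' := (ℓ * ℓ * Nat.clog 2 n) * (24 * (ℓ * ℓ * Nat.clog 2 n) + 20) + 7) ?_
    intro s₁ hf h7
    have e4 : s₁.reg 4 = 0 := (hf.reg 4 rfl).trans (by simpa using h4)
    have e2 : s₁.reg 2 = ℓ := (hf.reg 2 rfl).trans (by simpa using h2)
    apply Exec.le
    · apply Exec.arith_seq (by simp [e2]; omega)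
      apply Exec.arith_seq (by simp [e2, h7]; omega)
      refine Exec.seq (primeProg_spec (A := ℓ * ℓ * Nat.clog 2 n) (by simp [e2, h7])
        (by simpa using e4) hA.ne' hW2) (T' := 1) ?_
      rintro s₂ hf₂ ⟨hp, hlt, hle⟩
      have e4 : s₂.reg 4 = 0 := (hf₂.reg 4 rfl).trans (by simpa using e4)
      have e29 : s₂.reg 29 = ℓ * ℓ := (hf₂.reg 29 rfl).trans (by simp [e2])
      refine Exec.arith (by simp [e4]; omega) ?_
      simpa [e4, e29] using ⟨hp, hlt, hle⟩
    · omega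
  · omega

theorem sizesProg_spec {W n ℓ r : ℕ} {s : State} (h0 : s.reg 0 = n) (h29 : s.reg 29 = ℓ * ℓ)
    (h21 : s.reg 21 = r) (h4 : s.reg 4 = 0) (hr : 2 ≤ r)
    (hW : n * r + n + 1 < W ∧ (r + 1) * 2 + (r + 1) + 1 < W ∧
      3 * (ℓ * ℓ) < W ∧ 3 * (ℓ * ℓ) * Nat.clog 2 (r + 1) < W) :
    Exec W sizesProg s (8 * n + 8 * r + 30)
      (fun s' => s'.reg 23 = Nat.clog r n ∧ s'.reg 24 = 3 * (ℓ * ℓ) ∧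
        s'.reg 25 = 3 * (ℓ * ℓ) * Nat.clog 2 (r + 1)) := by
  obtain ⟨hW1, hW2, hW3, hW4⟩ := hW
  have hclog : Nat.clog r n ≤ n := Nat.clog_le_of_le_pow (Nat.lt_pow_self (by omega)).le
  have hnr : n ≤ n * r := Nat.le_mul_of_pos_right _ (by omega)
  apply Exec.le
  · apply Exec.arith_seq (by simp [h0, h4]; omega)
    apply Exec.arith_seq (by simp [h21, h4]; omega)
    refine Exec.seq (clogProg_spec (x := n) (b := r) (by simp [h0, h4]) (by simp [h21, h4]) hr hW1)
      (T' := 8 * r + 24) ?_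
    intro s₁ hf h7
    have e4 : s₁.reg 4 = 0 := (hf.reg 4 rfl).trans (by simpa using h4)
    have e21 : s₁.reg 21 = r := (hf.reg 21 rfl).trans (by simpa using h21)
    have e29 : s₁.reg 29 = ℓ * ℓ := (hf.reg 29 rfl).trans (by simpa using h29)
    apply Exec.le
    · apply Exec.arith_seq (by simp [h7, e4]; omega)
      apply Exec.arith_seq (by simp [e21, e4]; omega)
      apply Exec.incr_seq (by omega) (by decide) (by simp [e21, e4]; omega)
      apply Exec.const_seq (by omega)
      refine Exec.seq (clogProg_spec (x := r + 1) (b := 2) (by simp [e21, e4]) (by simp) le_rfl hW2)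
        (T' := 3) ?_
      intro s₂ hf₂ h7'
      have e29 : s₂.reg 29 = ℓ * ℓ := (hf₂.reg 29 rfl).trans (by simpa using e29)
      have e23 : s₂.reg 23 = Nat.clog r n := (hf₂.reg 23 rfl).trans (by simp [h7, e4])
      apply Exec.const_seq (by omega)
      apply Exec.arith_seq (by simp [e29]; omega)
      refine Exec.arith (by simp [e29, h7']; omega) ?_
      simp [e29, h7', e23]
    · omega
  · omega

theorem secondPrimeProg_spec {W q ℓ d N T : ℕ} {s : State} (h1 : s.reg 1 = q) (h2 : s.reg 2 = ℓ)
    (h4 : s.reg 4 = 0) (h23 : s.reg 23 = d) (h24 : s.reg 24 = N) (h25 : s.reg 25 = T)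
    (h29 : s.reg 29 = ℓ * ℓ) (hN : 0 < N) (hq : 0 < q)
    (hW : ℓ + 4 < W ∧ 4 * q < W ∧ 2 * (N * (4 * q) ^ ℓ) + 1 < W ∧ ∀ p, p ≤ 2 * (N * (4 * q) ^ ℓ) →
      0 < p → ℓ * ℓ * d < W ∧ ℓ * ℓ * d * T < W ∧ ℓ * ℓ * d * T * p < W ∧
        ℓ * ℓ * d * T * p * p < W) :
    Exec W secondPrimeProg s
      (4 * ℓ + (N * (4 * q) ^ ℓ) * (24 * (N * (4 * q) ^ ℓ) + 20) + 15)
      (fun s' => (s'.reg 26).Prime ∧ N * (4 * q) ^ ℓ < s'.reg 26 ∧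
        s'.reg 26 ≤ 2 * (N * (4 * q) ^ ℓ) ∧ s'.reg 28 = ℓ * ℓ * d * T * s'.reg 26 * s'.reg 26) := by
  obtain ⟨hW1, hW2, hW3, hW4⟩ := hW
  have hpow : ∀ j ≤ ℓ, N * (4 * q) ^ j ≤ N * (4 * q) ^ ℓ := fun j hj => by
    gcongr; omega
  have hN' := hpow 0 (Nat.zero_le _)
  rw [pow_zero, mul_one] at hN'
  have hA : 0 < N * (4 * q) ^ ℓ := by positivity
  apply Exec.le
  · apply Exec.arith_seq (by simp [h24, h4]; omega)
    apply Exec.const_seq (by omega)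
    apply Exec.arith_seq (by simp [h1]; omega)
    refine Exec.seq (R := fun s' => s'.reg 5 = N * (4 * q) ^ ℓ) (T := ℓ * (1 + 3) + 2)
      (T' := (N * (4 * q) ^ ℓ) * (24 * (N * (4 * q) ^ ℓ) + 20) + 9) ?_ ?_
    · refine Exec.forLoop (fun j s' => s'.reg 5 = N * (4 * q) ^ j) (by simpa using h2)
        (by omega) (by omega) (by decide) (by decide) (by simp [h24, h4]) ?_ (fun _ _ h => h)
      intro j s₁ hj hi hf h5
      have e16 : s₁.reg 16 = 4 * q := (hf.reg 16 rfl).trans (by simp [h1])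
      have := hpow (j + 1) hj
      rw [pow_succ, ← mul_assoc] at this
      refine Exec.arith (by simp [h5, e16]; omega) ?_
      simp [h5, e16, pow_succ, mul_assoc]
    · intro s₁ hf h5
      have e4 : s₁.reg 4 = 0 := (hf.reg 4 rfl).trans (by simpa using h4)
      have e23 : s₁.reg 23 = d := (hf.reg 23 rfl).trans (by simpa using h23)
      have e25 : s₁.reg 25 = T := (hf.reg 25 rfl).trans (by simpa using h25)
      have e29 : s₁.reg 29 = ℓ * ℓ := (hf.reg 29 rfl).trans (by simpa using h29)
      refine Exec.seq (primeProg_spec h5 e4 hA.ne' hW3) (T' := 5) ?_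
      rintro s₂ hf₂ ⟨hp, hlt, hle⟩
      have e4 : s₂.reg 4 = 0 := (hf₂.reg 4 rfl).trans e4
      have e23 : s₂.reg 23 = d := (hf₂.reg 23 rfl).trans e23
      have e25 : s₂.reg 25 = T := (hf₂.reg 25 rfl).trans e25
      have e29 : s₂.reg 29 = ℓ * ℓ := (hf₂.reg 29 rfl).trans e29
      obtain ⟨hw1, hw2, hw3, hw4⟩ := hW4 _ hle hp.pos
      apply Exec.arith_seq (by simp [e4]; omega)
      apply Exec.arith_seq (by simp [e29, e23]; omega)
      apply Exec.arith_seq (by simp [e29, e23, e25]; omega)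
      apply Exec.arith_seq (by simp [e29, e23, e25, e4]; omega)
      refine Exec.arith (by simp [e29, e23, e25, e4]; omega) ?_
      simpa [e29, e23, e25, e4] using ⟨hp, hlt, hle⟩
  · omega

end WordRAM

/-! ### Separation -/

namespace WordRAM

open Finset

theorem familyColour_digits {g : ℕ → ℕ} {q r T p a t x y u : ℕ} (ht : t < T) (hx : x < p)
    (hy : y < p) :
    familyColour g q r T p (((a * T + t) * p + x) * p + y) u = levelColour g q r p a t x y u := by
  have hdiv : ∀ b c d : ℕ, d < b → (c * b + d) / b = c := fun b c d h => by
    rw [mul_comm, Nat.mul_add_div (by omega), Nat.div_eq_of_lt h, add_zero]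
  have hmod : ∀ b c d : ℕ, d < b → (c * b + d) % b = d := fun b c d h => by
    rw [mul_comm, Nat.mul_add_mod, Nat.mod_eq_of_lt h]
  rw [familyColour, hdiv _ _ _ hy, hmod _ _ _ hy, hdiv _ _ _ hx, hmod _ _ _ hx, hdiv _ _ _ ht,
    hmod _ _ _ ht]

/-- Every colouring of every set of at most `ℓ` elements occurs in the family: a union bound over
the pairs of elements gives an injective function at each of the first two levels. -/
theorem exists_familyColour_eq {g : ℕ → ℕ} {n q ℓ r d lam p : ℕ} (hr : r.Prime) (hd : n ≤ r ^ d)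
    (hMr : ℓ * ℓ * d ≤ r) (hℓ : 1 ≤ ℓ) (hd1 : 1 ≤ d) (hlam : 1 ≤ lam) (hq : 1 ≤ q)
    (hg : ∀ y < r, (∀ t < 3 * (ℓ * ℓ) * lam, g (t * r + y) < 3 * (ℓ * ℓ)) ∧
      ∀ y' < r, y ≠ y' → collisions g r (3 * (ℓ * ℓ) * lam) y y' ≤ 3 * lam)
    (hp : p.Prime) (hpq : 3 * (ℓ * ℓ) * (4 * q) ^ ℓ < p) (S : Finset ℕ) (hS : S ⊆ range n)
    (hcard : #S ≤ ℓ) (col : ℕ → ℕ) (hcol : ∀ u ∈ S, col u < q) :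
    ∃ j < ℓ * ℓ * d * (3 * (ℓ * ℓ) * lam) * p * p,
      ∀ u ∈ S, familyColour g q r (3 * (ℓ * ℓ) * lam) p j u = col u := by
  classical
  have hll : ℓ * (ℓ - 1) + ℓ = ℓ * ℓ := by
    obtain ⟨l, rfl⟩ : ∃ l, ℓ = l + 1 := ⟨ℓ - 1, by omega⟩
    simp; ring
  obtain ⟨a, ha, hainj⟩ := exists_injOn_of_few_collisions (M := ℓ * ℓ * d) (c := d - 1) S
    (fun a u => rsHash r a u) hcard (fun u hu v hv huv => card_rsHash_collisions hr hMr
      ((mem_range.1 (hS hu)).trans_le hd) ((mem_range.1 (hS hv)).trans_le hd) huv) (by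
        have h1 : ℓ * (ℓ - 1) * (d - 1) ≤ ℓ * ℓ * (d - 1) := by gcongr; omega
        have h2 : ℓ * ℓ * (d - 1) < ℓ * ℓ * d := by gcongr; omega
        omega)
  have hcard' : #(S.image (rsHash r a)) ≤ ℓ := card_image_le.trans hcard
  have hltr : ∀ z ∈ S.image (rsHash r a), z < r := fun z hz => by
    obtain ⟨u, _, rfl⟩ := mem_image.1 hz
    exact rsHash_lt hr.pos a u
  obtain ⟨t, ht, htinj⟩ := exists_injOn_of_few_collisions (M := 3 * (ℓ * ℓ) * lam) (c := 3 * lam)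
    (S.image (rsHash r a)) (fun t z => g (t * r + z)) hcard'
    (fun u hu v hv huv => (hg u (hltr u hu)).2 v (hltr v hv) huv) (by
      have : ℓ * (ℓ - 1) * (3 * lam) < ℓ * ℓ * (3 * lam) := by gcongr; omega
      linarith)
  have hinj : Set.InjOn (fun u => g (t * r + rsHash r a u)) S := by
    intro u hu v hv huv
    exact hainj hu hv (htinj (mem_coe.2 (mem_image_of_mem _ hu))
      (mem_coe.2 (mem_image_of_mem _ hv)) huv)
  have hinv : ∀ u ∈ S, Function.invFunOn (fun u => g (t * r + rsHash r a u)) S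
      (g (t * r + rsHash r a u)) = u := fun u hu => hinj.leftInvOn_invFunOn hu
  have hpq2 : 2 * q ≤ p := by
    have h1 : 4 * q ≤ (4 * q) ^ ℓ := Nat.le_self_pow (by omega) _
    have h2 : 1 * (4 * q) ^ ℓ ≤ 3 * (ℓ * ℓ) * (4 * q) ^ ℓ := by gcongr; nlinarith
    omega
  obtain ⟨x, hx, y, hy, hxy⟩ := exists_geometric_colouring hp hq hpq2 hpq
    (S.image fun u => g (t * r + rsHash r a u))
    (fun i hi => by
      obtain ⟨u, _, rfl⟩ := mem_image.1 hi
      exact mem_range.2 ((hg _ (rsHash_lt hr.pos a u)).1 t ht))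
    (card_image_le.trans hcard)
    (fun i => col (Function.invFunOn (fun u => g (t * r + rsHash r a u)) S i))
    (fun i hi => by
      obtain ⟨u, hu, rfl⟩ := mem_image.1 hi
      simp only [hinv u hu]
      exact hcol u hu)
  refine ⟨((a * (3 * (ℓ * ℓ) * lam) + t) * p + x) * p + y, ?_, fun u hu => ?_⟩
  · have hlt : ∀ b c d e : ℕ, c < e → d < b → c * b + d < e * b := fun b c d e h h' => by
      have : (c + 1) * b ≤ e * b := Nat.mul_le_mul_right _ h
      rw [Nat.succ_mul] at this
      omega
    exact hlt _ _ _ _ (hlt _ _ _ _ (hlt _ _ _ _ ha ht) hx) hy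
  · rw [familyColour_digits ht hx hy, levelColour, hxy _ (mem_image_of_mem _ hu), hinv u hu]

/-- The family over an arbitrary numbered set `U`. -/
theorem separatesAll_family {U : Type*} {n q ℓ m : ℕ} (e : U ≃ Fin n) (k : Fin q → ℕ)
    (hk : ∑ i, k i = ℓ) (F : Fin m → U → Fin q)
    (hF : ∀ S ⊆ range n, #S ≤ ℓ → ∀ col : ℕ → ℕ, (∀ u ∈ S, col u < q) →
      ∃ j : Fin m, ∀ x : U, (e x : ℕ) ∈ S → (F j x : ℕ) = col (e x)) : SeparatesAll k F := by
  classical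
  intro A hA hAk
  have hex : ∀ v : ℕ, ∃ c : ℕ, ∀ i, ∀ x ∈ A i, (e x : ℕ) = v → c = i := by
    intro v
    by_cases h : ∃ i, ∃ x ∈ A i, (e x : ℕ) = v
    · obtain ⟨i, x, hx, hxv⟩ := h
      refine ⟨i, fun i' x' hx' hxv' => ?_⟩
      obtain rfl : x = x' := e.injective (Fin.ext (hxv.trans hxv'.symm))
      by_contra hne
      exact disjoint_left.1 (hA (fun h => hne (congrArg Fin.val h))) hx hx'
    · exact ⟨0, fun i x hx hxv => absurd ⟨i, x, hx, hxv⟩ h⟩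
  choose col hcol using hex
  obtain ⟨j, hj⟩ := hF ((univ.biUnion A).image fun x => (e x : ℕ))
    (fun v hv => by
      obtain ⟨x, _, rfl⟩ := mem_image.1 hv
      exact mem_range.2 (e x).2)
    (card_image_le.trans (card_biUnion_le.trans (by simp [hAk, hk]))) col
    (fun v hv => by
      obtain ⟨x, hx, rfl⟩ := mem_image.1 hv
      obtain ⟨i, _, hi⟩ := mem_biUnion.1 hx
      rw [hcol _ i x hi rfl]
      exact i.2)
  refine ⟨j, fun i x hx => Fin.ext ?_⟩
  rw [hj x (mem_image_of_mem _ (mem_biUnion.2 ⟨i, mem_univ _, hx⟩)), hcol _ i x hx rfl]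

end WordRAM

/-! ### Bounds on size, word length and time -/

namespace WordRAM

section bounds

theorem clog_two_sq_le {n : ℕ} (hn : 2 ≤ n) : Nat.clog 2 n ^ 2 ≤ 8 * n := by
  -- a strengthening of `(k + 1) ^ 2 ≤ 8 * 2 ^ k` for which the induction goes through
  have h : ∀ k : ℕ, k ^ 2 + 3 * k + 4 ≤ 8 * 2 ^ k := by
    intro k
    induction k with
    | zero => norm_num
    | succ k ih => rw [pow_succ 2 k]; nlinarith
  have h1 := Nat.pow_pred_clog_lt_self (b := 2) (by norm_num) (show 1 < n by omega)
  have h2 : 0 < Nat.clog 2 n := Nat.clog_pos (by norm_num) hn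
  have h3 := h (Nat.clog 2 n).pred
  have h4 : Nat.clog 2 n = (Nat.clog 2 n).pred + 1 := by simp; omega
  nlinarith

theorem clog_two_succ_le {r ℓ L : ℕ} (hr : r ≤ 2 * (ℓ * ℓ * L)) :
    Nat.clog 2 (r + 1) ≤ 1 + 2 * ℓ + L := by
  refine Nat.clog_le_of_le_pow ?_
  have h1 : ℓ + 1 ≤ 2 ^ ℓ := Nat.lt_two_pow_self
  have h2 : L + 1 ≤ 2 ^ L := Nat.lt_two_pow_self
  calc r + 1 ≤ 2 * ((ℓ + 1) * (ℓ + 1) * (L + 1)) := by nlinarith [Nat.zero_le (ℓ * ℓ)]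
    _ ≤ 2 * (2 ^ ℓ * 2 ^ ℓ * 2 ^ L) := by gcongr
    _ = 2 ^ (1 + 2 * ℓ + L) := by ring

/-- The lengths of the first two levels telescope: the number of base-`r` digits of a number below
`n`, times the number of bits of `r`, is about the number of bits of `n`. -/
theorem clog_mul_clog_le {n r ℓ : ℕ} (hn : 2 ≤ n) (hr2 : 2 ≤ r) (hℓ : 1 ≤ ℓ)
    (hr : r ≤ 2 * (ℓ * ℓ * Nat.clog 2 n)) :
    Nat.clog r n * Nat.clog 2 (r + 1) ≤ 6 * ℓ * Nat.clog 2 n := by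
  have hL : 0 < Nat.clog 2 n := Nat.clog_pos (by norm_num) hn
  have hlam := clog_two_succ_le hr
  have h1 := Nat.pow_pred_clog_lt_self (b := r) (by omega) (show 1 < n by omega)
  have h2 := Nat.pow_pred_clog_lt_self (b := 2) (by omega) (show 1 < r + 1 by omega)
  have h3 : Nat.clog r n ≤ Nat.clog 2 n := Nat.clog_le_of_le_pow
    ((Nat.le_pow_clog (by norm_num) n).trans (Nat.pow_le_pow_left hr2 _))
  have hd : 0 < Nat.clog r n := Nat.clog_pos (by omega) hn
  have hl : 0 < Nat.clog 2 (r + 1) := Nat.clog_pos (by omega) (by omega)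
  generalize Nat.clog r n = d at *
  generalize Nat.clog 2 (r + 1) = lam at *
  obtain ⟨d, rfl⟩ : ∃ d', d = d' + 1 := ⟨d - 1, by omega⟩
  obtain ⟨lam, rfl⟩ : ∃ d', lam = d' + 1 := ⟨lam - 1, by omega⟩
  simp only [Nat.pred_eq_sub_one, Nat.add_sub_cancel] at h1 h2
  have h4 : 2 ^ (lam * d) < 2 ^ Nat.clog 2 n := by
    calc 2 ^ (lam * d) = (2 ^ lam) ^ d := pow_mul _ _ _
      _ ≤ r ^ d := Nat.pow_le_pow_left (by omega) _
      _ < n := h1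
      _ ≤ _ := Nat.le_pow_clog (by norm_num) n
  have h5 := (Nat.pow_lt_pow_iff_right (by norm_num)).1 h4
  generalize Nat.clog 2 n = L at *
  have : 1 ≤ ℓ * L := Nat.mul_pos hℓ hL
  nlinarith

variable {q ℓ n : ℕ}

theorem two_le_pow (hq : 2 ≤ q) (hℓ : 1 ≤ ℓ) : 2 ≤ q ^ ℓ :=
  hq.trans (Nat.le_self_pow (by omega) q)

theorem le_pow_self (hq : 2 ≤ q) : ℓ ≤ q ^ ℓ := (Nat.lt_pow_self (by omega)).le

/-- The lower bound for the prime of the third level is at most a power of `q ^ ℓ`. -/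
theorem second_bound_le (hq : 2 ≤ q) (hℓ : 1 ≤ ℓ) :
    3 * (ℓ * ℓ) * (4 * q) ^ ℓ ≤ (q ^ ℓ) ^ 7 := by
  have h1 := le_pow_self (ℓ := ℓ) hq
  have h2 := two_le_pow hq hℓ
  have h4 : 4 ^ ℓ ≤ (q ^ ℓ) ^ 2 := by
    rw [← pow_mul, mul_comm ℓ 2, pow_mul]
    exact Nat.pow_le_pow_left (by nlinarith) ℓ
  have h3 : 3 ≤ (q ^ ℓ) ^ 2 := by nlinarith
  calc 3 * (ℓ * ℓ) * (4 * q) ^ ℓ = 3 * (ℓ * ℓ) * (4 ^ ℓ * q ^ ℓ) := by rw [mul_pow]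
    _ ≤ (q ^ ℓ) ^ 2 * (q ^ ℓ * q ^ ℓ) * ((q ^ ℓ) ^ 2 * q ^ ℓ) := by gcongr
    _ = (q ^ ℓ) ^ 7 := by ring

theorem family_size_le {d lam p L : ℕ} (hq : 2 ≤ q) (hℓ : 1 ≤ ℓ) (hdl : d * lam ≤ 6 * ℓ * L)
    (hp : p ≤ (q ^ ℓ) ^ 8) :
    ℓ * ℓ * d * (3 * (ℓ * ℓ) * lam) * p * p ≤ (q ^ ℓ) ^ 26 * L := by
  have h1 := le_pow_self (ℓ := ℓ) hq
  have h2 := two_le_pow hq hℓ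
  have h3 : 18 ≤ (q ^ ℓ) ^ 5 := (by norm_num : 18 ≤ 2 ^ 5).trans (Nat.pow_le_pow_left h2 5)
  calc ℓ * ℓ * d * (3 * (ℓ * ℓ) * lam) * p * p = 3 * ℓ ^ 4 * (d * lam) * p ^ 2 := by ring
    _ ≤ 3 * ℓ ^ 4 * (6 * ℓ * L) * ((q ^ ℓ) ^ 8) ^ 2 := by gcongr
    _ = 18 * ℓ ^ 5 * (q ^ ℓ) ^ 16 * L := by ring
    _ ≤ (q ^ ℓ) ^ 5 * (q ^ ℓ) ^ 5 * (q ^ ℓ) ^ 16 * L := by gcongr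
    _ = (q ^ ℓ) ^ 26 * L := by ring

end bounds

section wordBounds

/-! #### Word length

Sums and products of numbers that are bounded by powers of `X`. -/

variable {X a b i j : ℕ}

theorem mul_le_pow_add (ha : a ≤ X ^ i) (hb : b ≤ X ^ j) : a * b ≤ X ^ (i + j) := by
  rw [pow_add]; exact Nat.mul_le_mul ha hb

theorem add_le_pow_add (hX : 2 ≤ X) (ha : a ≤ X ^ i) (hb : b ≤ X ^ j) :
    a + b ≤ X ^ (i + j + 1) := by
  have h1 : X ^ i ≤ X ^ (i + j) := Nat.pow_le_pow_right (by omega) (by omega)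
  have h2 : X ^ j ≤ X ^ (i + j) := Nat.pow_le_pow_right (by omega) (by omega)
  rw [pow_succ]
  nlinarith

end wordBounds

section timeBounds

/-! #### Time

The running times of the stages are bounded by powers of `Y = q ^ ℓ` times `n L`, where
`L = ⌈log₂ n⌉`; since `Y ≥ 2`, powers of `Y` absorb the constants. -/

variable {Y n L ℓ : ℕ}

theorem const_le_pow {c i : ℕ} (hY : 2 ≤ Y) (h : c ≤ 2 ^ i) : c ≤ Y ^ i :=
  h.trans (Nat.pow_le_pow_left hY i)

theorem const_mul_le_pow {a c i j Z : ℕ} (hY : 2 ≤ Y) (h : a ≤ c * (Y ^ i * Z)) (hc : c ≤ 2 ^ j) :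
    a ≤ Y ^ (i + j) * Z := by
  calc a ≤ c * (Y ^ i * Z) := h
    _ ≤ Y ^ j * (Y ^ i * Z) := Nat.mul_le_mul_right _ (const_le_pow hY hc)
    _ = Y ^ (i + j) * Z := by ring

theorem primeProg_time_le (A : ℕ) : A * (24 * A + 20) ≤ 44 * A ^ 2 := by
  rcases Nat.eq_zero_or_pos A with rfl | h
  · simp
  · nlinarith

theorem firstPrime_time_le (hY : 2 ≤ Y) (hℓ : ℓ ≤ Y) (hn : 1 ≤ n) (hL : 1 ≤ L)
    (hLL : L ^ 2 ≤ 8 * n) :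
    8 * n + (ℓ * ℓ * L) * (24 * (ℓ * ℓ * L) + 20) + 13 ≤ Y ^ 14 * (n * L) := by
  have hZn : n ≤ n * L := Nat.le_mul_of_pos_right _ hL
  have h5 : (ℓ * ℓ * L) ^ 2 ≤ Y ^ 7 * (n * L) := by
    calc (ℓ * ℓ * L) ^ 2 ≤ (Y * Y * L) ^ 2 := by gcongr
      _ = Y ^ 4 * L ^ 2 := by ring
      _ ≤ Y ^ 4 * (Y ^ 3 * (n * L)) := by
          gcongr
          exact hLL.trans (Nat.mul_le_mul (const_le_pow hY (by norm_num)) hZn)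
      _ = Y ^ 7 * (n * L) := by ring
  have h6 := primeProg_time_le (ℓ * ℓ * L)
  have h7 : n * L ≤ Y ^ 7 * (n * L) := Nat.le_mul_of_pos_left _ (by positivity)
  exact const_mul_le_pow hY (c := 65) (i := 7) (j := 7) (by omega) (by norm_num)

theorem secondPrime_time_le {A : ℕ} (hY : 2 ≤ Y) (hℓ : ℓ ≤ Y) (hZ : 1 ≤ n * L) (hA : A ≤ Y ^ 7) :
    4 * ℓ + A * (24 * A + 20) + 15 ≤ Y ^ 20 * (n * L) := by
  have h5 : A ^ 2 ≤ Y ^ 14 := by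
    calc A ^ 2 ≤ (Y ^ 7) ^ 2 := by gcongr
      _ = Y ^ 14 := by ring
  have h6 := primeProg_time_le A
  have h7 : Y ≤ Y ^ 14 := Nat.le_self_pow (by norm_num) _
  have h8 : Y ^ 14 ≤ Y ^ 14 * (n * L) := Nat.le_mul_of_pos_right _ hZ
  exact const_mul_le_pow hY (c := 63) (i := 14) (j := 6) (by omega) (by norm_num)

theorem sizes_time_le {r : ℕ} (hY : 2 ≤ Y) (hn : 1 ≤ n) (hL : 1 ≤ L)
    (hr : r ≤ 2 * (Y ^ 2 * L)) : 8 * n + 8 * r + 30 ≤ Y ^ 8 * (n * L) := by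
  have hZn : n ≤ n * L := Nat.le_mul_of_pos_right _ hL
  have h5 : Y ^ 2 * L ≤ Y ^ 2 * (n * L) := by
    gcongr
    exact Nat.le_mul_of_pos_left _ hn
  have h7 : n * L ≤ Y ^ 2 * (n * L) := Nat.le_mul_of_pos_left _ (by positivity)
  exact const_mul_le_pow hY (c := 54) (i := 2) (j := 6) (by omega) (by norm_num)

theorem greedy_time_le {r lam : ℕ} (hY : 2 ≤ Y) (hℓ : ℓ ≤ Y) (hn : 1 ≤ n) (hL : 1 ≤ L)
    (hLL : L ^ 2 ≤ 8 * n) (hr : r ≤ 2 * (Y ^ 2 * L)) (hlam : lam ≤ 4 * (Y * L)) :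
    3 * (ℓ * ℓ) * lam * (r * (12 * (3 * (ℓ * ℓ)) + 27 * r + 18) + 6) + 2 ≤
      Y ^ 22 * (n * L) := by
  have hYL1 : 1 ≤ Y ^ 2 * L := Nat.mul_pos (by positivity) hL
  have hll : ℓ * ℓ ≤ Y ^ 2 := by rw [sq]; exact Nat.mul_le_mul hℓ hℓ
  have h5 : 12 * (3 * (ℓ * ℓ)) + 27 * r + 18 ≤ 108 * (Y ^ 2 * L) := by
    have : ℓ * ℓ ≤ Y ^ 2 * L := hll.trans (Nat.le_mul_of_pos_right _ hL)
    omega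
  have h6 : r * (12 * (3 * (ℓ * ℓ)) + 27 * r + 18) + 6 ≤ 222 * (Y ^ 2 * L) ^ 2 := by
    have := Nat.mul_le_mul hr h5
    nlinarith
  have h7 : 3 * (ℓ * ℓ) * lam ≤ 12 * (Y ^ 3 * L) := by
    calc 3 * (ℓ * ℓ) * lam ≤ 3 * Y ^ 2 * (4 * (Y * L)) := by gcongr
      _ = 12 * (Y ^ 3 * L) := by ring
  have hLL3 : L ^ 3 ≤ Y ^ 3 * (n * L) := by
    calc L ^ 3 = L ^ 2 * L := by ring
      _ ≤ 8 * n * L := Nat.mul_le_mul_right _ hLL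
      _ = 8 * (n * L) := by ring
      _ ≤ Y ^ 3 * (n * L) := Nat.mul_le_mul_right _ (const_le_pow hY (by norm_num))
  have h8 : 3 * (ℓ * ℓ) * lam * (r * (12 * (3 * (ℓ * ℓ)) + 27 * r + 18) + 6) ≤
      2664 * (Y ^ 10 * (n * L)) := by
    calc _ ≤ 12 * (Y ^ 3 * L) * (222 * (Y ^ 2 * L) ^ 2) := Nat.mul_le_mul h7 h6
      _ = 2664 * Y ^ 7 * L ^ 3 := by ring
      _ ≤ 2664 * Y ^ 7 * (Y ^ 3 * (n * L)) := by gcongr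
      _ = 2664 * (Y ^ 10 * (n * L)) := by ring
  have h9 : 1 ≤ Y ^ 10 * (n * L) := Nat.mul_pos (by positivity) (Nat.mul_pos hn hL)
  exact const_mul_le_pow hY (c := 2666) (i := 10) (j := 12) (by omega) (by norm_num)

theorem output_time_le {m : ℕ} (hY : 2 ≤ Y) (hℓ : ℓ ≤ Y) (hn : 1 ≤ n) (hL : 1 ≤ L)
    (hm : m ≤ Y ^ 26 * L) : m * (n * (5 * (3 * (ℓ * ℓ)) + 23) + 13) + 2 ≤ Y ^ 34 * (n * L) := by
  have hll : ℓ * ℓ ≤ Y ^ 2 := by rw [sq]; exact Nat.mul_le_mul hℓ hℓ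
  have hY1 : 1 ≤ Y ^ 2 := Nat.one_le_pow _ _ (by omega)
  have h5 : 5 * (3 * (ℓ * ℓ)) + 23 ≤ 38 * Y ^ 2 := by omega
  have h6 : n * (5 * (3 * (ℓ * ℓ)) + 23) + 13 ≤ 51 * (n * Y ^ 2) := by
    have := Nat.mul_le_mul_left n h5
    have h7 : 1 ≤ n * Y ^ 2 := Nat.mul_pos (by omega) hY1
    linarith
  have h7 : m * (n * (5 * (3 * (ℓ * ℓ)) + 23) + 13) ≤ 51 * (Y ^ 28 * (n * L)) := by
    calc _ ≤ Y ^ 26 * L * (51 * (n * Y ^ 2)) := Nat.mul_le_mul hm h6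
      _ = 51 * (Y ^ 28 * (n * L)) := by ring
  have h8 : 1 ≤ Y ^ 28 * (n * L) := Nat.mul_pos (by positivity) (Nat.mul_pos hn hL)
  exact const_mul_le_pow hY (c := 53) (i := 28) (j := 6) (by omega) (by norm_num)

theorem pow_mul_add_le {i j Z : ℕ} (hY : 2 ≤ Y) (hij : i ≤ j) :
    Y ^ i * Z + Y ^ j * Z ≤ Y ^ (j + 1) * Z := by
  have h1 : Y ^ i * Z ≤ Y ^ j * Z :=
    Nat.mul_le_mul_right _ (Nat.pow_le_pow_right (by omega) hij)
  have h2 : 2 * (Y ^ j * Z) ≤ Y * (Y ^ j * Z) := Nat.mul_le_mul_right _ hY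
  calc Y ^ i * Z + Y ^ j * Z ≤ 2 * (Y ^ j * Z) := by omega
    _ ≤ Y * (Y ^ j * Z) := h2
    _ = Y ^ (j + 1) * Z := by ring

end timeBounds

open Finset

local infixr:65 " ;; " => Program.seq

/-- What the program achieves: register `0` holds the number `m ≤ B` of functions, bank `1` their
value tables, and every colouring of every set of at most `ℓ` elements occurs. -/
def FamilyPost (n q ℓ B : ℕ) (s : State) : Prop :=
  ∃ (m : ℕ) (f : ℕ → ℕ → ℕ), m ≤ B ∧ s.reg 0 = m ∧
    (∀ j < m, ∀ u < n, s.mem 1 (j * n + u) = f j u) ∧ (∀ j u, f j u < q) ∧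
    ∀ S ⊆ range n, #S ≤ ℓ → ∀ col : ℕ → ℕ, (∀ u ∈ S, col u < q) →
      ∃ j < m, ∀ u ∈ S, f j u = col u

theorem greedy_output_spec {W n q ℓ r d lam p m B : ℕ} {s : State} (h0 : s.reg 0 = n)
    (h1 : s.reg 1 = q) (h4 : s.reg 4 = 0) (h21 : s.reg 21 = r) (h24 : s.reg 24 = 3 * (ℓ * ℓ))
    (h25 : s.reg 25 = 3 * (ℓ * ℓ) * lam) (h26 : s.reg 26 = p) (h28 : s.reg 28 = m)
    (hmem2 : ∀ i, s.mem 2 i = 0) (hmem4 : ∀ i, s.mem 4 i = 0)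
    (hr : r.Prime) (hd : n ≤ r ^ d) (hMr : ℓ * ℓ * d ≤ r) (hℓ : 1 ≤ ℓ) (hd1 : 1 ≤ d)
    (hlam : 1 ≤ lam) (hrlam : r ≤ 2 ^ lam) (hq : 1 ≤ q) (hp : p.Prime)
    (hpq : 3 * (ℓ * ℓ) * (4 * q) ^ ℓ < p)
    (hm : m = ℓ * ℓ * d * (3 * (ℓ * ℓ) * lam) * p * p) (hmB : m ≤ B)
    (hW : 2 * 2 ^ (3 * lam) + 1 < W ∧ 3 * (ℓ * ℓ) * lam * r + r < W ∧ r * r + r < W ∧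
      3 * (ℓ * ℓ) * lam + 3 * (ℓ * ℓ) + 1 < W ∧ n < W ∧ p * p < W ∧ p * q < W ∧
      m * n + m + n < W) :
    Exec W (greedyProg ;; outputProg ;; move 0 28) s
      ((3 * (ℓ * ℓ) * lam * (r * (12 * (3 * (ℓ * ℓ)) + 27 * r + 18) + 6) + 2) +
        ((m * (n * (5 * (3 * (ℓ * ℓ)) + 23) + 13) + 2) + 1)) (FamilyPost n q ℓ B) := by
  obtain ⟨hW1, hW2, hW3, hW4, hW5, hW6, hW7, hW8⟩ := hW
  have hN : 0 < 3 * (ℓ * ℓ) := by positivity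
  refine Exec.seq (greedyProg_spec h21 h24 h25 h4 hN hrlam hmem4 ⟨hW1, hW2, hW3, hW4⟩) ?_
  intro s₁ hf₁ hg
  refine Exec.seq (outputProg_spec (n := n) (q := q) (r := r) (p := p) (T := 3 * (ℓ * ℓ) * lam)
    (N := 3 * (ℓ * ℓ)) (m := m) ((hf₁.reg 0 rfl).trans h0) ((hf₁.reg 1 rfl).trans h1)
    ((hf₁.reg 4 rfl).trans h4) ((hf₁.reg 21 rfl).trans h21) ((hf₁.reg 25 rfl).trans h25)
    ((hf₁.reg 26 rfl).trans h26) ((hf₁.reg 28 rfl).trans h28) hr.two_le hp.pos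
    (Nat.mul_pos hN hlam) ?_ (fun t ht z hz => (hg z hz).1 t ht)
    (fun i => by rw [hf₁.mem 2 rfl, hmem2]) ⟨hW5, hW3, hW2, by omega, hW6, hW7, hW8⟩) ?_
  · rw [hm]
    exact Nat.mul_le_mul_right _ (Nat.mul_le_mul_right _ (Nat.mul_le_mul_right _ hMr))
  intro s₂ hf₂ hout
  have e28 : s₂.reg 28 = m := (hf₂.reg 28 rfl).trans ((hf₁.reg 28 rfl).trans h28)
  have e4 : s₂.reg 4 = 0 := (hf₂.reg 4 rfl).trans ((hf₁.reg 4 rfl).trans h4)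
  refine Exec.arith (by simp [e28, e4]; omega) ?_
  refine ⟨m, familyColour (s₁.mem 3) q r (3 * (ℓ * ℓ) * lam) p, hmB, by simp [e28, e4],
    by simpa using hout, fun j u => levelColour_lt hp.pos (by omega), ?_⟩
  intro S hS hcard col hcol
  rw [hm]
  exact exists_familyColour_eq hr hd hMr hℓ hd1 hlam hq hg hp hpq S hS hcard col hcol

theorem familyProg_spec {n q ℓ : ℕ} {s : State} (hn : 2 ≤ n) (hq : 2 ≤ q) (hℓ : 1 ≤ ℓ)
    (h0 : s.reg 0 = n) (h1 : s.reg 1 = q) (h2 : s.reg 2 = ℓ) (h4 : s.reg 4 = 0)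
    (hmem2 : ∀ i, s.mem 2 i = 0) (hmem4 : ∀ i, s.mem 4 i = 0) :
    Exec ((n + ℓ + q ^ (ℓ + 1)) ^ 100) familyProg s ((q ^ ℓ) ^ 40 * (n * Nat.clog 2 n))
      (FamilyPost n q ℓ ((q ^ ℓ) ^ 26 * Nat.clog 2 n)) := by
  have hY2 : 2 ≤ q ^ ℓ := two_le_pow hq hℓ
  have hℓY : ℓ ≤ q ^ ℓ := le_pow_self hq
  have hA := second_bound_le hq hℓ
  have hqX : q ^ (ℓ + 1) = q ^ ℓ * q := pow_succ q ℓ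
  obtain ⟨L, hLdef⟩ : ∃ L, Nat.clog 2 n = L := ⟨_, rfl⟩
  obtain ⟨Y, hYdef⟩ : ∃ Y, q ^ ℓ = Y := ⟨_, rfl⟩
  obtain ⟨X, hXdef⟩ : ∃ X, n + ℓ + q ^ (ℓ + 1) = X := ⟨_, rfl⟩
  have hL : 0 < L := hLdef ▸ Nat.clog_pos (by norm_num) hn
  rw [hXdef, hYdef, hLdef]
  rw [hYdef] at hY2 hℓY hA hqX
  -- `X` is at least `2 + 1 + 4`, so it also bounds the constants of the program
  have hX7 : 7 ≤ X := by nlinarith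
  have hX2 : 2 ≤ X := by omega
  -- every number of the computation is bounded by a power of `X`
  have hXn : n ≤ X ^ 1 := by rw [pow_one]; omega
  have hXℓ : ℓ ≤ X ^ 1 := by rw [pow_one]; omega
  have hXq : q ≤ X ^ 1 := by rw [pow_one]; nlinarith
  have hXY : Y ≤ X := by nlinarith
  have hXL : L ≤ X ^ 1 :=
    hLdef ▸ (Nat.clog_le_of_le_pow (Nat.lt_pow_self (by omega)).le).trans hXn
  have hXc : ∀ c ≤ 7, c ≤ X ^ 1 := fun c hc => by rw [pow_one]; omega
  have hXlt : ∀ {a i : ℕ}, a ≤ X ^ i → i < 100 → a < X ^ 100 := fun h hi =>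
    h.trans_lt (Nat.pow_lt_pow_right (by omega) hi)
  have hXA : 3 * (ℓ * ℓ) * (4 * q) ^ ℓ ≤ X ^ 7 := hA.trans (Nat.pow_le_pow_left hXY 7)
  have hLL : L ^ 2 ≤ 8 * n := hLdef ▸ clog_two_sq_le hn
  have hn1 : 1 ≤ n := by omega
  have ht₁ := firstPrime_time_le hY2 hℓY hn1 hL hLL
  refine Exec.le (Exec.seq ((firstPrimeProg_spec h0 h2 h4 hn hℓ ⟨?_, ?_⟩).le
    (T' := Y ^ 14 * (n * L)) (hLdef ▸ ht₁)) (T' := Y ^ 39 * (n * L)) ?_)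
    (pow_mul_add_le hY2 (by norm_num))
  · exact hXlt (add_le_pow_add hX2 (add_le_pow_add hX2 (mul_le_pow_add hXn (hXc 2 (by norm_num)))
      hXn) (hXc 1 (by norm_num))) (by norm_num)
  · rw [hLdef]
    exact hXlt (add_le_pow_add hX2 (mul_le_pow_add (hXc 2 (by norm_num))
      (mul_le_pow_add (mul_le_pow_add hXℓ hXℓ) hXL)) (hXc 1 (by norm_num))) (by norm_num)
  rintro s₁ hf₁ ⟨e29, hrp, hrlt, hrle⟩
  generalize hrdef : s₁.reg 21 = r at hrp hrlt hrle
  have hr2 := hrp.two_le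
  have hdl := clog_mul_clog_le hn hr2 hℓ hrle
  have hdL : Nat.clog r n ≤ Nat.clog 2 n := Nat.clog_le_of_le_pow
    ((Nat.le_pow_clog (by norm_num) n).trans (Nat.pow_le_pow_left hr2 _))
  have hnd : n ≤ r ^ Nat.clog r n := Nat.le_pow_clog (by omega) n
  rw [hLdef] at hrlt hrle hdL hdl
  have hdpos : 0 < Nat.clog r n := Nat.clog_pos (by omega) hn
  have hrlam := Nat.le_pow_clog (b := 2) (by norm_num) (r + 1)
  have hlampos : 0 < Nat.clog 2 (r + 1) := Nat.clog_pos (by omega) (by omega)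
  have hlamr : Nat.clog 2 (r + 1) ≤ r := Nat.clog_le_of_le_pow Nat.lt_two_pow_self
  have hlam2 : 2 ^ Nat.clog 2 (r + 1) ≤ 2 * r := by
    have h5 := Nat.pow_pred_clog_lt_self (b := 2) (by norm_num) (show 1 < r + 1 by omega)
    rw [← Nat.succ_pred_eq_of_pos hlampos, pow_succ']
    omega
  have hlamYL : Nat.clog 2 (r + 1) ≤ 4 * (Y * L) := by
    have h5 := clog_two_succ_le hrle
    have h6 : Y ≤ Y * L := Nat.le_mul_of_pos_right _ hL
    have h7 : L ≤ Y * L := Nat.le_mul_of_pos_left _ (by omega)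
    omega
  have hXr : r ≤ X ^ 4 := hrle.trans (mul_le_pow_add (hXc 2 (by norm_num))
    (mul_le_pow_add (mul_le_pow_add hXℓ hXℓ) hXL))
  have hXd := hdL.trans hXL
  have hXlam := hlamr.trans hXr
  have hX3lam : 2 ^ (3 * Nat.clog 2 (r + 1)) ≤ X ^ 15 := by
    calc 2 ^ (3 * Nat.clog 2 (r + 1)) = (2 ^ Nat.clog 2 (r + 1)) ^ 3 := by rw [← pow_mul, mul_comm]
      _ ≤ (X ^ 5) ^ 3 := Nat.pow_le_pow_left
          (hlam2.trans (mul_le_pow_add (i := 1) (hXc 2 (by norm_num)) hXr)) 3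
      _ = X ^ 15 := by rw [← pow_mul]
  have hXN : 3 * (ℓ * ℓ) ≤ X ^ 3 := mul_le_pow_add (hXc 3 (by norm_num)) (mul_le_pow_add hXℓ hXℓ)
  have hXT := mul_le_pow_add hXN hXlam
  have hrYL : r ≤ 2 * (Y ^ 2 * L) := by
    refine hrle.trans (Nat.mul_le_mul_left _ (Nat.mul_le_mul_right _ ?_))
    rw [sq]; exact Nat.mul_le_mul hℓY hℓY
  have ht₂ := sizes_time_le hY2 hn1 hL hrYL
  refine Exec.le (Exec.seq ((sizesProg_spec ((hf₁.reg 0 rfl).trans h0) e29 hrdef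
    ((hf₁.reg 4 rfl).trans h4) hr2 ⟨?_, ?_, ?_, ?_⟩).le ht₂) (T' := Y ^ 38 * (n * L)) ?_)
    (pow_mul_add_le hY2 (by norm_num))
  · exact hXlt (add_le_pow_add hX2 (add_le_pow_add hX2 (mul_le_pow_add hXn hXr) hXn)
      (hXc 1 (by norm_num))) (by norm_num)
  · have h5 := add_le_pow_add hX2 hXr (hXc 1 (by norm_num))
    exact hXlt (add_le_pow_add hX2 (add_le_pow_add hX2
      (mul_le_pow_add h5 (hXc 2 (by norm_num))) h5) (hXc 1 (by norm_num))) (by norm_num)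
  · exact hXlt hXN (by norm_num)
  · exact hXlt hXT (by norm_num)
  rintro s₂ hf₂ ⟨e23, e24, e25⟩
  generalize Nat.clog r n = d at *
  generalize Nat.clog 2 (r + 1) = lam at *
  have ht₃ := secondPrime_time_le hY2 hℓY (Nat.mul_pos hn1 hL) hA
  have hXp : ∀ p ≤ 2 * (3 * (ℓ * ℓ) * (4 * q) ^ ℓ), p ≤ X ^ 8 := fun p hp =>
    hp.trans (mul_le_pow_add (i := 1) (hXc 2 (by norm_num)) hXA)
  have hXM := mul_le_pow_add (mul_le_pow_add hXℓ hXℓ) hXd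
  have hXMT := mul_le_pow_add hXM hXT
  have hXm : ∀ p ≤ 2 * (3 * (ℓ * ℓ) * (4 * q) ^ ℓ),
      ℓ * ℓ * d * (3 * (ℓ * ℓ) * lam) * p * p ≤ X ^ 26 := fun p hp =>
    mul_le_pow_add (mul_le_pow_add hXMT (hXp p hp)) (hXp p hp)
  refine Exec.le (Exec.seq ((secondPrimeProg_spec ((hf₂.reg 1 rfl).trans ((hf₁.reg 1 rfl).trans h1))
    ((hf₂.reg 2 rfl).trans ((hf₁.reg 2 rfl).trans h2))
    ((hf₂.reg 4 rfl).trans ((hf₁.reg 4 rfl).trans h4)) e23 e24 e25 ((hf₂.reg 29 rfl).trans e29)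
    (by positivity) (by omega) ⟨?_, ?_, ?_, fun p hp _ => ⟨?_, ?_, ?_, ?_⟩⟩).le ht₃)
    (T' := Y ^ 37 * (n * L)) ?_) (pow_mul_add_le hY2 (by norm_num))
  · exact hXlt (add_le_pow_add hX2 hXℓ (hXc 4 (by norm_num))) (by norm_num)
  · exact hXlt (mul_le_pow_add (hXc 4 (by norm_num)) hXq) (by norm_num)
  · exact hXlt (add_le_pow_add hX2 (mul_le_pow_add (hXc 2 (by norm_num)) hXA)
      (hXc 1 (by norm_num))) (by norm_num)
  · exact hXlt hXM (by norm_num)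
  · exact hXlt hXMT (by norm_num)
  · exact hXlt (mul_le_pow_add hXMT (hXp p hp)) (by norm_num)
  · exact hXlt (hXm p hp) (by norm_num)
  rintro s₃ hf₃ ⟨hpp, hplt, hple, e28⟩
  generalize hpdef : s₃.reg 26 = p at hpp hplt hple e28
  have hpY : p ≤ Y ^ 8 := by
    calc p ≤ Y * Y ^ 7 := hple.trans (Nat.mul_le_mul hY2 hA)
      _ = Y ^ 8 := by ring
  have hmle : ℓ * ℓ * d * (3 * (ℓ * ℓ) * lam) * p * p ≤ Y ^ 26 * L := by
    subst hYdef
    exact family_size_le hq hℓ hdl hpY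
  have hXm' := hXm p hple
  have ht₄ := greedy_time_le hY2 hℓY hn1 hL hLL hrYL hlamYL
  have ht₅ := output_time_le hY2 hℓY hn1 hL hmle
  generalize hm : ℓ * ℓ * d * (3 * (ℓ * ℓ) * lam) * p * p = m at *
  refine Exec.le (greedy_output_spec
    ((hf₃.reg 0 rfl).trans ((hf₂.reg 0 rfl).trans ((hf₁.reg 0 rfl).trans h0)))
    ((hf₃.reg 1 rfl).trans ((hf₂.reg 1 rfl).trans ((hf₁.reg 1 rfl).trans h1)))
    ((hf₃.reg 4 rfl).trans ((hf₂.reg 4 rfl).trans ((hf₁.reg 4 rfl).trans h4)))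
    ((hf₃.reg 21 rfl).trans ((hf₂.reg 21 rfl).trans hrdef)) ((hf₃.reg 24 rfl).trans e24)
    ((hf₃.reg 25 rfl).trans e25) hpdef e28
    (fun i => by rw [hf₃.mem 2 rfl, hf₂.mem 2 rfl, hf₁.mem 2 rfl, hmem2])
    (fun i => by rw [hf₃.mem 4 rfl, hf₂.mem 4 rfl, hf₁.mem 4 rfl, hmem4])
    hrp hnd ((Nat.mul_le_mul_left _ hdL).trans hrlt.le) hℓ hdpos hlampos
    ((Nat.le_succ r).trans hrlam) (by omega) hpp hplt hm.symm hmle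
    ⟨?_, ?_, ?_, ?_, ?_, ?_, ?_, ?_⟩) ?_
  · exact hXlt (add_le_pow_add hX2 (mul_le_pow_add (hXc 2 (by norm_num)) hX3lam)
      (hXc 1 (by norm_num))) (by norm_num)
  · exact hXlt (add_le_pow_add hX2 (mul_le_pow_add hXT hXr) hXr) (by norm_num)
  · exact hXlt (add_le_pow_add hX2 (mul_le_pow_add hXr hXr) hXr) (by norm_num)
  · exact hXlt (add_le_pow_add hX2 (add_le_pow_add hX2 hXT hXN) (hXc 1 (by norm_num)))
      (by norm_num)
  · exact hXlt hXn (by norm_num)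
  · exact hXlt (mul_le_pow_add (hXp p hple) (hXp p hple)) (by norm_num)
  · exact hXlt (mul_le_pow_add (hXp p hple) hXq) (by norm_num)
  · exact hXlt (add_le_pow_add hX2 (add_le_pow_add hX2 (mul_le_pow_add hXm' hXn) hXm') hXn)
      (by norm_num)
  · have h5 : 1 ≤ Y ^ 34 * (n * L) := Nat.mul_pos (by positivity) (Nat.mul_pos hn1 hL)
    have h6 : Y ^ 34 * (n * L) + Y ^ 34 * (n * L) ≤ Y ^ 35 * (n * L) := pow_mul_add_le hY2 le_rfl
    have h7 : Y ^ 22 * (n * L) + Y ^ 35 * (n * L) ≤ Y ^ 36 * (n * L) :=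
      pow_mul_add_le hY2 (by norm_num)
    have h8 : Y ^ 36 * (n * L) ≤ Y ^ 37 * (n * L) :=
      Nat.mul_le_mul_right _ (Nat.pow_le_pow_right (by omega) (by norm_num))
    exact (Nat.add_le_add ht₄ ((Nat.add_le_add ht₅ h5).trans h6)).trans (h7.trans h8)

end WordRAM

/-! ### The result -/

namespace WordRAM

open Finset

theorem clog_two_le_logb {n : ℕ} (hn : 2 ≤ n) : (Nat.clog 2 n : ℝ) ≤ 2 * Real.logb 2 n := by
  have h1 : (1 : ℝ) ≤ Real.logb 2 n := by
    rw [Real.le_logb_iff_rpow_le (by norm_num) (by positivity), Real.rpow_one]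
    exact_mod_cast hn
  have h2 := Nat.pow_pred_clog_lt_self (b := 2) (by norm_num) (show 1 < n by omega)
  have h3 : ((Nat.clog 2 n).pred : ℝ) ≤ Real.logb 2 n := by
    rw [Real.le_logb_iff_rpow_le (by norm_num) (by positivity), Real.rpow_natCast]
    exact_mod_cast h2.le
  have h4 : Nat.clog 2 n = (Nat.clog 2 n).pred + 1 :=
    (Nat.succ_pred_eq_of_pos (Nat.clog_pos (by norm_num) hn)).symm
  rw [h4]
  push_cast
  linarith

theorem one_le_logb_two {n : ℕ} (hn : 2 ≤ n) : (1 : ℝ) ≤ Real.logb 2 n := by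
  rw [Real.le_logb_iff_rpow_le (by norm_num) (by positivity), Real.rpow_one]
  exact_mod_cast hn

theorem mainProg_spec_of_trivial {n q ℓ : ℕ} (hn : 2 ≤ n) (hq : 1 ≤ q) (hqℓ : q = 1 ∨ ℓ = 0)
    (k : Fin q → ℕ) :
    Exec ((n + ℓ + q ^ (ℓ + 1)) ^ 100) mainProg (inputState n q ℓ k) 5 (FamilyPost n q ℓ 1) := by
  have hX : 1 < (n + ℓ + q ^ (ℓ + 1)) ^ 100 := Nat.one_lt_pow (by norm_num) (by omega)
  have htriv : ∀ s : State, (∀ i, s.mem 1 i = 0) →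
      Exec ((n + ℓ + q ^ (ℓ + 1)) ^ 100) (.const 0 1) s 1 (FamilyPost n q ℓ 1) := by
    intro s hs
    refine Exec.const hX ⟨1, fun _ _ => 0, le_rfl, by simp, by simpa using fun u _ => hs u,
      fun _ _ => hq, ?_⟩
    intro S _ hcard col hcol
    refine ⟨0, Nat.one_pos, fun u hu => ?_⟩
    show 0 = col u
    have h1 := hcol u hu
    have h2 := card_pos.2 ⟨u, hu⟩
    omega
  have hmem : ∀ x v i, ((inputState n q ℓ k).setReg x v).mem 1 i = 0 := fun x v i => by
    simp [inputState]
  refine Exec.const_seq (T := 4) hX (Exec.ite (T := 2) (T' := 1) (fun h => ?_)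
    fun _ => htriv _ (hmem _ _))
  refine Exec.ite (T := 0) (T' := 1) (fun h' => ?_) fun _ => htriv _ (hmem _ _)
  simp [inputState] at h h'
  omega

theorem mainProg_spec {n q ℓ : ℕ} (hn : 2 ≤ n) (hq : 2 ≤ q) (hℓ : 1 ≤ ℓ) (k : Fin q → ℕ) :
    Exec ((n + ℓ + q ^ (ℓ + 1)) ^ 100) mainProg (inputState n q ℓ k)
      ((q ^ ℓ) ^ 40 * (n * Nat.clog 2 n) + 5)
      (FamilyPost n q ℓ ((q ^ ℓ) ^ 26 * Nat.clog 2 n)) := by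
  have hX : 1 < (n + ℓ + q ^ (ℓ + 1)) ^ 100 := Nat.one_lt_pow (by norm_num) (by omega)
  refine Exec.const_seq hX (Exec.ite (T := (q ^ ℓ) ^ 40 * (n * Nat.clog 2 n) + 2) (T' := 1)
    (fun _ => ?_) fun h => ?_)
  · refine Exec.ite (T' := 1) (fun _ => ?_) fun h => ?_
    · exact familyProg_spec hn hq hℓ (by simp [inputState]) (by simp [inputState])
        (by simp [inputState]) (by simp [inputState]) (by simp [inputState])
        (by simp [inputState])
    · simp [inputState] at h
      omega
  · simp [inputState] at h
    omega

/-- A run of the program that ends with a family yields the family over the set `U`. -/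
theorem exists_family_of_exec {U : Type*} {n q ℓ T B C : ℕ} (e : U ≃ Fin n) (k : Fin q → ℕ)
    (hk : ∑ i, k i = ℓ)
    (h : Exec ((n + ℓ + q ^ (ℓ + 1)) ^ C) mainProg (inputState n q ℓ k) T (FamilyPost n q ℓ B)) :
    ∃ (m : ℕ) (F : Fin m → U → Fin q), m ≤ B ∧ SeparatesAll k F ∧ ∃ (t : ℕ) (s : State),
      Run ((n + ℓ + q ^ (ℓ + 1)) ^ C) mainProg (inputState n q ℓ k) t s ∧ t ≤ T ∧
        HoldsFamily e F s := by
  obtain ⟨t, s, ht, hrun, m, f, hm, h0, h1, hlt, hsep⟩ := h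
  refine ⟨m, fun j u => ⟨f j (e u), hlt j (e u)⟩, hm, ?_, t, s, hrun, ht, h0,
    fun j u => h1 j j.2 (e u) (e u).2⟩
  refine separatesAll_family e k hk _ fun S hS hcard col hcol => ?_
  obtain ⟨j, hj, hjS⟩ := hsep S hS hcard col hcol
  exact ⟨⟨j, hj⟩, fun x hx => hjS _ hx⟩

end WordRAM

theorem mainTheorem12 :
    ∃ (P : WordRAM.Program) (C : ℕ),
      ∀ (U : Type*) (n q ℓ : ℕ) (e : U ≃ Fin n) (k : Fin q → ℕ),
        2 ≤ n → 1 ≤ q → ∑ i, k i = ℓ →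
        ∃ (m : ℕ) (F : Fin m → U → Fin q),
          (m : ℝ) ≤ (q : ℝ) ^ (C * ℓ) * Real.logb 2 n ∧
          SeparatesAll k F ∧
          ∃ (t : ℕ) (s : WordRAM.State),
            WordRAM.Run ((n + ℓ + q ^ (ℓ + 1)) ^ C) P (inputState n q ℓ k) t s ∧
            (t : ℝ) ≤ C * (q : ℝ) ^ (C * ℓ) * n * Real.logb 2 n ∧
            HoldsFamily e F s := by
  -- `100` exceeds all exponents that occur; one factor `q ^ ℓ ≥ 2` turns `⌈log₂ n⌉` into `log₂ n`
  refine ⟨WordRAM.mainProg, 100, fun U n q ℓ e k hn hq hk => ?_⟩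
  have hlog := WordRAM.one_le_logb_two hn
  have hq1 : (1 : ℝ) ≤ q := by exact_mod_cast hq
  have hn1 : (1 : ℝ) ≤ n := by exact_mod_cast (by omega : 1 ≤ n)
  have hpow : (1 : ℝ) ≤ (q : ℝ) ^ (100 * ℓ) := one_le_pow₀ hq1
  by_cases htriv : q = 1 ∨ ℓ = 0
  · obtain ⟨m, F, hm, hsep, t, s, hrun, ht, hF⟩ := WordRAM.exists_family_of_exec e k hk
      (WordRAM.mainProg_spec_of_trivial hn hq htriv k)
    refine ⟨m, F, ?_, hsep, t, s, hrun, ?_, hF⟩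
    · calc (m : ℝ) ≤ 1 := by exact_mod_cast hm
        _ ≤ _ := one_le_mul_of_one_le_of_one_le hpow hlog
    · have ht' : (t : ℝ) ≤ 5 := by exact_mod_cast ht
      have := one_le_mul_of_one_le_of_one_le (one_le_mul_of_one_le_of_one_le hpow hn1) hlog
      push_cast
      nlinarith
  · push Not at htriv
    have hq2 : 2 ≤ q := by omega
    have hℓ : 1 ≤ ℓ := by omega
    obtain ⟨m, F, hm, hsep, t, s, hrun, ht, hF⟩ := WordRAM.exists_family_of_exec e k hk
      (WordRAM.mainProg_spec hn hq2 hℓ k)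
    have hL := WordRAM.clog_two_le_logb hn
    have hY : (1 : ℝ) ≤ ((q ^ ℓ : ℕ) : ℝ) := by exact_mod_cast Nat.one_le_pow _ _ hq
    have hY2 : (2 : ℝ) ≤ ((q ^ ℓ : ℕ) : ℝ) := by exact_mod_cast WordRAM.two_le_pow hq2 hℓ
    have hYq : ((q ^ ℓ : ℕ) : ℝ) ^ 100 = (q : ℝ) ^ (100 * ℓ) := by
      push_cast
      rw [← pow_mul, mul_comm]
    have hm' : (m : ℝ) ≤ ((q ^ ℓ : ℕ) : ℝ) ^ 26 * Nat.clog 2 n := by exact_mod_cast hm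
    have ht' : (t : ℝ) ≤ ((q ^ ℓ : ℕ) : ℝ) ^ 40 * (n * Nat.clog 2 n) + 5 := by exact_mod_cast ht
    rw [← hYq] at hpow ⊢
    generalize ((q ^ ℓ : ℕ) : ℝ) = Y at *
    refine ⟨m, F, ?_, hsep, t, s, hrun, ?_, hF⟩
    · calc (m : ℝ) ≤ Y ^ 26 * (Y * Real.logb 2 n) :=
            hm'.trans (by gcongr; exact hL.trans (by gcongr))
        _ = Y ^ 27 * Real.logb 2 n := by ring
        _ ≤ Y ^ 100 * Real.logb 2 n := by gcongr; norm_num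
    · have h1 := one_le_mul_of_one_le_of_one_le (one_le_mul_of_one_le_of_one_le hpow hn1) hlog
      have h2 : Y ^ 40 * (n * Nat.clog 2 n) ≤ 2 * (Y ^ 100 * n * Real.logb 2 n) := by
        calc Y ^ 40 * (n * Nat.clog 2 n) ≤ Y ^ 100 * (n * (2 * Real.logb 2 n)) := by
              gcongr
              norm_num
          _ = _ := by ring
      push_cast
      nlinarith
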